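/- **Theorem (Minimax lower bound).** *Setting.* Fix constants $0<\underline q\le\overline q\le\infty$. Suppose that for each sample size $n$ we are given integers $1\le d=d_n\le p=p_n$ and $R=R_n\ge 1$, reals $\lambda=\lambda_n>0$ and $\bar\alpha=\bar\alpha_n\in(0,1]$, a partition $\mathfrak X=(\Xi_1,\dots,\Xi_R)$ of $[0,1]^d$ into boxes (products of intervals), smoothness vectors $\alpha_r=(\alpha_{r1},\dots,\alpha_{rd})\in(0,1]^d$ with $\bar\alpha^{-1}=d^{-1}\sum_{j=1}^d\alpha_{rj}^{-1}$ for every $r=1,\dots,R$, and a probability measure $Q=Q_n$ on $[0,1]^p$ that has a Lebesgue density $q$ with $\underline q\le q\le\overline q$ on $[0,1]^p$. We observe independent pairs $(X_i,Y_i)$, $i=1,\dots,n$, with $Y_i=f_0(X_i)+\varepsilon_i$, $X_i\sim Q$, and $\varepsilon_i\sim\mathrm N(0,1)$ independent of $X_i$. For $M>0$ let $\overline\Gamma$ be the set of all functions $f:[0,1]^p\to\mathbb R$ with $\sup_x|f(x)|\le M\lambda$ such that $f(x)=h(x_S)$ for some $S\subseteq\{1,\dots,p\}$ with $|S|=d$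 and some $h:[0,1]^d\to\mathbb R$ that satisfies, for every $r$, $$|h(x)-h(y)|\le\lambda\sum_{j=1}^d|x_j-y_j|^{\alpha_{rj}},\qquad x,y\in\Xi_r .$$ For a set $\mathcal F$ of functions on $[0,1]^p$ define the minimax risk by $$r_n^2(\mathcal F,Q)=\inf_{\hat f}\ \sup_{f_0\in\mathcal F}\ \mathbb E_{f_0,Q}\int(\hat f-f_0)^2\,dQ ,$$ the infimum being over all measurable function estimators $\hat f$ based on the sample, and let $$\gamma_n=\sqrt{\tfrac1n\log\tbinom pd}+\Big(\frac{\lambda^{d/\bar\alpha}}{n}\Big)^{\bar\alpha/(2\bar\alpha+d)} .$$ *Claim.* There are constants $M_k>0$, $k\ge 1$, depending only on $k$ and on the density bounds $\underline q,\overline q$, such that the following holds for every $M>0$ and all sequences as above. Let $\mathrm{len}([\Xi_r]_j)$ be the length of the $j$-th side of $\Xi_r$. If there is a constant $C>0$ such that $\log\mathrm{len}([\Xi_r]_j)\ge -C/\alpha_{rj}$ for all $n,r,j$ (in particular all these lengths are positive), if $d\,\gamma_n\to0$, and if $\gamma_n/\lambda\to0$ (automatic from $d\,\gamma_n\to 0$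 when $\lambda$ is bounded away from $0$), then for all sufficiently large $n$ $$r_n\big(\overline\Gamma\cap\mathcal C([0,1]^p),\,Q\big)\ \ge\ M_{d}\,\gamma_n .$$ -/

import Mathlib

open MeasureTheory ProbabilityTheory Filter Asymptotics unitInterval
open scoped ENNReal Topology

/-- The cube `[0,1]^k`, with its product topology, Borel sigma-algebra and Lebesgue measure. -/
abbrev Cube (k : ℕ) : Type := Fin k → I

/-- A box: a product of intervals of `[0,1]` (each one closed, open or half-closed). -/
def IsBox {d : ℕ} (E : Set (Cube d)) : Prop :=
  ∃ J : Fin d → Set I, (∀ j, (J j).OrdConnected) ∧ E = Set.univ.pi J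

/-- A box partition of `[0,1]^d` with `R` boxes. -/
structure IsBoxPartition {d R : ℕ} (Xi : Fin R → Set (Cube d)) : Prop where
  isBox : ∀ r, IsBox (Xi r)
  disjoint : ∀ r s, r ≠ s → Disjoint (Xi r) (Xi s)
  cover : ⋃ r, Xi r = Set.univ

/-- The length `len([E]_j)` of the projection of `E` to the `j`-th coordinate. -/
noncomputable def projLen {d : ℕ} (E : Set (Cube d)) (j : Fin d) : ℝ :=
  (volume ((fun x : Cube d => (x j : ℝ)) '' E)).toReal

/-- The set of `R`-tuples of smoothness vectors in `(0,1]^d` that all have harmonic mean `abar`. -/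
def smoothnessTuples (R d : ℕ) (abar : ℝ) : Set (Fin R → Fin d → ℝ) :=
  {A | ∀ r, (∀ j, 0 < A r j ∧ A r j ≤ 1) ∧
    abar⁻¹ = (d : ℝ)⁻¹ * ∑ j, (A r j)⁻¹}

/-- `h` restricted to `E` is anisotropic `a`-Hölder with coefficient `L`. -/
def AnisoHolderOn {d : ℕ} (L : ℝ) (a : Fin d → ℝ) (E : Set (Cube d)) (h : Cube d → ℝ) : Prop :=
  ∀ x ∈ E, ∀ y ∈ E, |h x - h y| ≤ L * ∑ j, |(x j : ℝ) - (y j : ℝ)| ^ (a j)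

/-- The piecewise heterogeneous anisotropic Hölder space over the boxes `Xi`. -/
def piecewiseHolder {d R : ℕ} (L : ℝ) (A : Fin R → Fin d → ℝ) (Xi : Fin R → Set (Cube d)) :
    Set (Cube d → ℝ) :=
  {h | ∀ r, AnisoHolderOn L (A r) (Xi r) h}

/-- The map `h ↦ (x ↦ h (x_S))`, where `x_S` lists the coordinates of `x` in `S` increasingly. -/
def liftCoords {d p : ℕ} (S : Finset (Fin p)) (hS : S.card = d) (h : Cube d → ℝ) :
    Cube p → ℝ :=
  fun x => h (fun i => x (S.orderEmbOfFin hS i))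

/-- The `d`-sparse piecewise heterogeneous anisotropic Hölder space on `[0,1]^p`. -/
def sparseHolder {d R : ℕ} (p : ℕ) (L : ℝ) (A : Fin R → Fin d → ℝ)
    (Xi : Fin R → Set (Cube d)) : Set (Cube p → ℝ) :=
  ⋃ (S : Finset (Fin p)) (hS : S.card = d), liftCoords S hS '' piecewiseHolder L A Xi

/-- The members of the sparse space with supremum norm at most `M * L`. -/
def boundedSparseHolder {d R : ℕ} (p : ℕ) (L M : ℝ) (A : Fin R → Fin d → ℝ)
    (Xi : Fin R → Set (Cube d)) : Set (Cube p → ℝ) :=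
  {f | f ∈ sparseHolder p L A Xi ∧ ∀ x, |f x| ≤ M * L}

/-- `Q` has a density with respect to Lebesgue measure on `[0,1]^p` with values in `[lo, hi]`. -/
def HasDensityBetween {p : ℕ} (Q : Measure (Cube p)) (lo hi : ℝ≥0∞) : Prop :=
  ∃ q : Cube p → ℝ≥0∞, Measurable q ∧ (∀ x, lo ≤ q x ∧ q x ≤ hi) ∧ Q = volume.withDensity q

/-- The law of one observation `(X, f X + ε)`, with `X ∼ Q` and `ε ∼ N(0,1)` independent. -/
noncomputable def obsLaw {p : ℕ} (Q : Measure (Cube p)) (f : Cube p → ℝ) : Measure (Cube p × ℝ) :=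
  (Q.prod (gaussianReal 0 1)).map (fun z => (z.1, f z.1 + z.2))

/-- The law of `n` independent observations. -/
noncomputable def sampleLaw {p : ℕ} (n : ℕ) (Q : Measure (Cube p)) (f : Cube p → ℝ) :
    Measure (Fin n → Cube p × ℝ) :=
  Measure.pi (fun _ => obsLaw Q f)

/-- The expected squared `L₂(Q)`-loss of the estimator `est` when the true function is `f`. -/
noncomputable def l2Risk {p : ℕ} (n : ℕ) (Q : Measure (Cube p))
    (est : (Fin n → Cube p × ℝ) → Cube p → ℝ) (f : Cube p → ℝ) : ℝ≥0∞ :=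
  ∫⁻ z, ∫⁻ x, ENNReal.ofReal ((est z x - f x) ^ 2) ∂Q ∂(sampleLaw n Q f)

/-- The minimax `L₂(Q)`-risk `r_n(F, Q)`. Estimators are the jointly measurable functions of the
sample and the point; one that is not square integrable merely has an infinite loss. -/
noncomputable def minimaxL2Risk {p : ℕ} (n : ℕ) (F : Set (Cube p → ℝ)) (Q : Measure (Cube p)) :
    ℝ≥0∞ :=
  (⨅ (est : (Fin n → Cube p × ℝ) → Cube p → ℝ) (_ : Measurable (Function.uncurry est)),
    ⨆ f ∈ F, l2Risk n Q est f) ^ (1 / 2 : ℝ)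

/-- The rate `√(n⁻¹ log C(p,d)) + (L^{d/abar} / n)^{abar/(2 abar + d)}`. -/
noncomputable def minimaxRate (n p d : ℕ) (L abar : ℝ) : ℝ :=
  Real.sqrt ((n : ℝ)⁻¹ * Real.log (p.choose d)) +
    (L ^ ((d : ℝ) / abar) / n) ^ (abar / (2 * abar + d))

/-! The rate is a sum of two terms, so it suffices to bound the worst-case risk below by the square
of each, up to constants depending on `d` and on the lower density bound. Both bounds are testing
arguments based on the second moment of a likelihood ratio, which for Gaussian noise is exactly `(∫
exp((g - f)²) dQ)ⁿ` (`exists_sample_likelihood_ratio`).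

Not knowing `S` costs `ρ = n⁻¹ log C(p,d)`. The functions `τ ∏_{j ∈ S} x_j`, one for each `S`,
belong to the class whatever the partition, and their mutual distances are of order `τ` for fixed
`d`. With `n τ² = ½ log C(p,d)` the sample cannot identify `S` (`multiple_hypotheses_risk`,
`selection_risk`).

Not knowing `h` costs `s²`, where `s` is the second term of the rate. Each box is cut into cells
with sides of order `(s/L)^(1/α_rj)`, each carrying a bump of height `s`. Since all boxes share the
harmonic mean, all cells have volume of order `(s/L)^(d/abar)`, and volume alone counts them. The
value of `s` makes `n s²` times this volume equal to one, so a typical bump cannot be detected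
reliably, and Assouad's argument over all sums of bumps yields a risk of order `s²` (`exists_bumps`,
`hypercube_risk`, `smoothness_risk`). The length condition together with `γ_n/λ → 0` ensures that
every box holds a cell.

The larger term decides which bound is used. The selection bound needs `C(p,d) ≥ 256`; otherwise `√ρ
≤ 3s` because `s² ≥ 1/n`. -/

/-! ### Testing bounds from second moments of likelihood ratios. -/

section LikelihoodRatio

variable {Ω : Type*} [MeasurableSpace Ω]

/-- Two-point testing bound in terms of the second moment of the likelihood ratio. -/
theorem two_point_bound {P : Measure Ω} {ℓ : Ω → ℝ≥0∞} (hℓ : Measurable ℓ)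
    (hone : ∫⁻ z, ℓ z ∂P = 1) {E : ℝ} (hE0 : 0 ≤ E)
    (hE : ∫⁻ z, ℓ z ^ 2 ∂P ≤ ENNReal.ofReal E)
    {a b : Ω → ℝ≥0∞} (ha : Measurable a) (hb : Measurable b) {s : ℝ≥0∞}
    (hs : ∀ z, s ≤ a z + b z) :
    s * ENNReal.ofReal (1 / (1 + E)) ≤ ∫⁻ z, a z ∂P + ∫⁻ z, b z ∂(P.withDensity ℓ) := by
  set t : ℝ := 1 / (1 + E) with ht
  have ht0 : 0 < t := by positivity
  have hmin : ENNReal.ofReal t ≤ ∫⁻ z, min 1 (ℓ z) ∂P := by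
    -- A linearised Cauchy–Schwarz inequality: `2tx ≤ m + t² x²/m` with `m = min 1 x`, and `x²/m = x
    -- · max 1 x ≤ x + x²`. The value of `t` makes `t²(1 + E) = t`, so integrating leaves `t ≤ ∫ min
    -- 1 ℓ`.
    have hpt : ∀ z, ENNReal.ofReal (2 * t) * ℓ z ≤
        min 1 (ℓ z) + ENNReal.ofReal (t ^ 2) * (ℓ z + ℓ z ^ 2) := by
      intro z
      by_cases htop : ℓ z = ∞
      · rw [htop]
        simp [ENNReal.mul_top, ht0.ne', ht0]
      · obtain ⟨x, hx⟩ : ∃ x : NNReal, ℓ z = x := ⟨(ℓ z).toNNReal, (ENNReal.coe_toNNReal htop).symm⟩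
        have hx' : (x : ℝ≥0∞) = ENNReal.ofReal (x : ℝ) := by simp
        have hmin' : min 1 (ENNReal.ofReal (x : ℝ)) = ENNReal.ofReal (min 1 (x : ℝ)) := by
          rw [ENNReal.ofReal_min]; simp
        have hx0 : (0 : ℝ) ≤ x := x.2
        rw [hx, hx', hmin', ← ENNReal.ofReal_pow hx0, ← ENNReal.ofReal_add hx0 (by positivity),
          ← ENNReal.ofReal_mul (by positivity), ← ENNReal.ofReal_mul (by positivity),
          ← ENNReal.ofReal_add (by positivity) (by positivity)]
        apply ENNReal.ofReal_le_ofReal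
        rcases le_total (x : ℝ) 1 with h | h
        · rw [min_eq_right h]
          nlinarith [mul_nonneg hx0 (sq_nonneg (t - 1)), mul_nonneg hx0 (mul_nonneg (sq_nonneg t) hx0)]
        · rw [min_eq_left h]
          nlinarith [sq_nonneg (t * x - 1), mul_nonneg (sq_nonneg t) hx0]
    have hint : ENNReal.ofReal (2 * t) ≤
        ∫⁻ z, min 1 (ℓ z) ∂P + ENNReal.ofReal (t ^ 2) * (1 + ENNReal.ofReal E) := by
      calc ENNReal.ofReal (2 * t) = ∫⁻ z, ENNReal.ofReal (2 * t) * ℓ z ∂P := by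
            rw [lintegral_const_mul _ hℓ, hone, mul_one]
        _ ≤ ∫⁻ z, (min 1 (ℓ z) + ENNReal.ofReal (t ^ 2) * (ℓ z + ℓ z ^ 2)) ∂P :=
            lintegral_mono hpt
        _ = ∫⁻ z, min 1 (ℓ z) ∂P +
              ENNReal.ofReal (t ^ 2) * (∫⁻ z, ℓ z ∂P + ∫⁻ z, ℓ z ^ 2 ∂P) := by
            rw [lintegral_add_left (by fun_prop), lintegral_const_mul _ (by fun_prop),
              lintegral_add_left hℓ]
        _ ≤ _ := by rw [hone]; gcongr
    have hval : ENNReal.ofReal (t ^ 2) * (1 + ENNReal.ofReal E) = ENNReal.ofReal t := by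
      rw [← ENNReal.ofReal_one, ← ENNReal.ofReal_add zero_le_one hE0,
        ← ENNReal.ofReal_mul (by positivity)]
      congr 1
      rw [ht]; field_simp
    rw [hval, two_mul, ENNReal.ofReal_add ht0.le ht0.le] at hint
    exact (ENNReal.add_le_add_iff_right ENNReal.ofReal_ne_top).1 hint
  rw [lintegral_withDensity_eq_lintegral_mul _ hℓ hb, ← lintegral_add_left ha]
  calc s * ENNReal.ofReal t ≤ s * ∫⁻ z, min 1 (ℓ z) ∂P := by gcongr
    _ = ∫⁻ z, s * min 1 (ℓ z) ∂P := (lintegral_const_mul _ (by fun_prop)).symm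
    _ ≤ _ := by
      apply lintegral_mono
      intro z
      simp only [Pi.mul_apply]
      calc s * min 1 (ℓ z) ≤ (a z + b z) * min 1 (ℓ z) := by gcongr; exact hs z
        _ = a z * min 1 (ℓ z) + b z * min 1 (ℓ z) := add_mul ..
        _ ≤ a z * 1 + b z * ℓ z := by
            gcongr
            · exact min_le_left ..
            · exact min_le_right ..
        _ = _ := by rw [mul_one, mul_comm (b z)]

/-- Multiple testing bound: disjoint events cannot all have large probability under measures with
bounded second moment of the likelihood ratio. -/
theorem sum_disjoint_events_le {ι : Type*} [Fintype ι] {P : Measure Ω} [IsProbabilityMeasure P]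
    {ℓ : ι → Ω → ℝ≥0∞} (hℓ : ∀ i, Measurable (ℓ i)) {E : ℝ≥0∞}
    (hE : ∀ i, ∫⁻ z, ℓ i z ^ 2 ∂P ≤ E) {S : ι → Set Ω} (hS : ∀ i, MeasurableSet (S i))
    (hdisj : Pairwise fun i j => Disjoint (S i) (S j)) {K : ℝ≥0∞} (hK0 : K ≠ 0) (hK : K ≠ ∞) :
    ∑ i, P.withDensity (ℓ i) (S i) ≤ K + Fintype.card ι * (K⁻¹ * E) := by
  -- Truncation at `K`: the first term is paid only on `S i`, and by disjointness these payments add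
  -- up to at most `K`.
  have hpt : ∀ x : ℝ≥0∞, x ≤ K + K⁻¹ * x ^ 2 := by
    intro x
    rcases le_total x K with h | h
    · exact h.trans le_self_add
    · refine le_trans ?_ le_add_self
      calc x = K⁻¹ * K * x := by rw [ENNReal.inv_mul_cancel hK0 hK, one_mul]
        _ ≤ K⁻¹ * x * x := by gcongr
        _ = _ := by ring
  have hi : ∀ i, P.withDensity (ℓ i) (S i) ≤ K * P (S i) + K⁻¹ * E := by
    intro i
    rw [withDensity_apply _ (hS i)]
    calc ∫⁻ z in S i, ℓ i z ∂P ≤ ∫⁻ z in S i, (K + K⁻¹ * ℓ i z ^ 2) ∂P :=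
          lintegral_mono fun z => hpt _
      _ = K * P (S i) + ∫⁻ z in S i, K⁻¹ * ℓ i z ^ 2 ∂P := by
          rw [lintegral_add_left measurable_const, setLIntegral_const]
      _ ≤ K * P (S i) + ∫⁻ z, K⁻¹ * ℓ i z ^ 2 ∂P := by
          gcongr; exact Measure.restrict_le_self
      _ ≤ _ := by
          have := hℓ i
          rw [lintegral_const_mul _ (by fun_prop)]
          gcongr
          exact hE i
  calc ∑ i, P.withDensity (ℓ i) (S i) ≤ ∑ i, (K * P (S i) + K⁻¹ * E) :=
        Finset.sum_le_sum fun i _ => hi i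
    _ = K * P (⋃ i, S i) + Fintype.card ι * (K⁻¹ * E) := by
        rw [Finset.sum_add_distrib, ← Finset.mul_sum, measure_iUnion hdisj hS, tsum_fintype]
        simp
    _ ≤ K * 1 + Fintype.card ι * (K⁻¹ * E) := by gcongr; exact prob_le_one
    _ = _ := by rw [mul_one]

end LikelihoodRatio

/-! ### Densities of product measures. -/

section PiWithDensity

theorem lintegral_pi_prod {ι Ω : Type*} [Fintype ι] [MeasurableSpace Ω] (P : Measure Ω)
    [IsProbabilityMeasure P] (g : ι → Ω → ℝ≥0∞) (hg : ∀ i, Measurable (g i)) :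
    ∫⁻ z, ∏ i, g i (z i) ∂(Measure.pi fun _ : ι => P) = ∏ i, ∫⁻ y, g i y ∂P := by
  have h := lintegral_prod_eq_prod_lintegral_of_indepFun (μ := Measure.pi fun _ : ι => P)
    Finset.univ (fun i z => g i (z i)) (iIndepFun_pi fun i => (hg i).aemeasurable)
    (fun i => (hg i).comp (measurable_pi_apply i))
  rw [h]
  refine Finset.prod_congr rfl fun i _ => ?_
  rw [← (measurePreserving_eval (fun _ : ι => P) i).lintegral_comp (hg i)]

theorem pi_withDensity_eq {ι Ω : Type*} [Fintype ι] [MeasurableSpace Ω] (P : Measure Ω)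
    [IsProbabilityMeasure P] {ℓ : Ω → ℝ≥0∞} (hℓ : Measurable ℓ)
    [IsProbabilityMeasure (P.withDensity ℓ)] :
    Measure.pi (fun _ : ι => P.withDensity ℓ) =
      (Measure.pi fun _ : ι => P).withDensity fun z => ∏ i, ℓ (z i) := by
  refine Measure.pi_eq fun s hs => ?_
  rw [withDensity_apply _ (MeasurableSet.univ_pi hs), ← lintegral_indicator (MeasurableSet.univ_pi hs)]
  have h : ∀ z : ι → Ω, (Set.univ.pi s).indicator (fun z => ∏ i, ℓ (z i)) z =
      ∏ i, (s i).indicator ℓ (z i) := by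
    intro z
    by_cases hz : z ∈ Set.univ.pi s
    · rw [Set.indicator_of_mem hz]
      exact Finset.prod_congr rfl fun i _ => (Set.indicator_of_mem (hz i trivial) _).symm
    · rw [Set.indicator_of_notMem hz]
      simp only [Set.mem_pi, not_forall, Set.mem_univ, true_implies] at hz
      obtain ⟨i, hi⟩ := hz
      exact (Finset.prod_eq_zero (Finset.mem_univ i) (Set.indicator_of_notMem hi _)).symm
  simp_rw [h]
  rw [lintegral_pi_prod P _ fun i => hℓ.indicator (hs i)]
  refine Finset.prod_congr rfl fun i _ => ?_
  rw [lintegral_indicator (hs i), withDensity_apply _ (hs i)]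

end PiWithDensity

/-! ### Change of mean for Gaussian noise. -/

section GaussianShift

theorem lintegral_gaussianReal_shift (a b : ℝ) {F : ℝ → ℝ≥0∞} (hF : Measurable F) :
    ∫⁻ e, F (b + e) ∂(gaussianReal 0 1) =
      ∫⁻ e, F (a + e) * ENNReal.ofReal (Real.exp ((b - a) * e - (b - a) ^ 2 / 2))
        ∂(gaussianReal 0 1) := by
  have h1 : ∫⁻ e, F (b + e) ∂(gaussianReal 0 1) = ∫⁻ y, F y ∂(gaussianReal b 1) := by
    rw [← zero_add b, ← gaussianReal_map_const_add b, lintegral_map hF (by fun_prop)]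
    simp
  have h2 : ∫⁻ e, F (a + e) * ENNReal.ofReal (Real.exp ((b - a) * e - (b - a) ^ 2 / 2))
      ∂(gaussianReal 0 1) = ∫⁻ y, F y *
        ENNReal.ofReal (Real.exp ((b - a) * (y - a) - (b - a) ^ 2 / 2)) ∂(gaussianReal a 1) := by
    rw [← zero_add a, ← gaussianReal_map_const_add a, lintegral_map (by fun_prop) (by fun_prop)]
    simp
  rw [h1, h2, gaussianReal_of_var_ne_zero _ one_ne_zero, gaussianReal_of_var_ne_zero _ one_ne_zero,
    lintegral_withDensity_eq_lintegral_mul _ (measurable_gaussianPDF _ _) hF,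
    lintegral_withDensity_eq_lintegral_mul _ (measurable_gaussianPDF _ _) (by fun_prop)]
  congr 1
  ext y
  simp only [Pi.mul_apply, gaussianPDF, gaussianPDFReal]
  rw [mul_comm (F y), ← mul_assoc, ← ENNReal.ofReal_mul (by positivity),
    mul_assoc _ (Real.exp _) (Real.exp _), ← Real.exp_add]
  congr 4
  push_cast
  ring

/-- A constant test function in the shift formula gives the moment generating function. -/
theorem lintegral_exp_mul_gaussianReal (t c : ℝ) :
    ∫⁻ e, ENNReal.ofReal (Real.exp (t * e + c)) ∂(gaussianReal 0 1) =
      ENNReal.ofReal (Real.exp (t ^ 2 / 2 + c)) := by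
  have h := lintegral_gaussianReal_shift 0 t
    (F := fun _ => ENNReal.ofReal (Real.exp (t ^ 2 / 2 + c))) measurable_const
  simp only [lintegral_const, measure_univ, mul_one] at h
  rw [h]
  congr 1
  ext e
  rw [← ENNReal.ofReal_mul (by positivity), ← Real.exp_add]
  congr 2
  ring

end GaussianShift

/-! ### Likelihood ratio of the regression sample. -/

section SampleLikelihood

variable {p : ℕ}

theorem lintegral_obsLaw (Q : Measure (Cube p)) [IsProbabilityMeasure Q] {f : Cube p → ℝ}
    (hf : Measurable f) {F : Cube p × ℝ → ℝ≥0∞} (hF : Measurable F) :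
    ∫⁻ z, F z ∂(obsLaw Q f) = ∫⁻ x, ∫⁻ e, F (x, f x + e) ∂(gaussianReal 0 1) ∂Q := by
  rw [obsLaw, lintegral_map hF (by fun_prop), lintegral_prod _ (by fun_prop)]

/-- The likelihood ratio of one observation under the regression functions `g` and `f`. -/
noncomputable def obsRatio (f g : Cube p → ℝ) (z : Cube p × ℝ) : ℝ≥0∞ :=
  ENNReal.ofReal (Real.exp ((g z.1 - f z.1) * (z.2 - f z.1) - (g z.1 - f z.1) ^ 2 / 2))

theorem measurable_obsRatio {f g : Cube p → ℝ} (hf : Measurable f) (hg : Measurable g) :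
    Measurable (obsRatio f g) := by
  unfold obsRatio; fun_prop

theorem isProbabilityMeasure_obsLaw (Q : Measure (Cube p)) [IsProbabilityMeasure Q]
    {f : Cube p → ℝ} (hf : Measurable f) : IsProbabilityMeasure (obsLaw Q f) :=
  Measure.isProbabilityMeasure_map (by fun_prop)

theorem obsLaw_eq_withDensity (Q : Measure (Cube p)) [IsProbabilityMeasure Q]
    {f g : Cube p → ℝ} (hf : Measurable f) (hg : Measurable g) :
    obsLaw Q g = (obsLaw Q f).withDensity (obsRatio f g) := by
  have hr := measurable_obsRatio hf hg
  refine Measure.ext_of_lintegral _ fun F hF => ?_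
  rw [lintegral_withDensity_eq_lintegral_mul _ hr hF,
    lintegral_obsLaw Q hg hF, lintegral_obsLaw Q hf (hr.mul hF)]
  congr 1
  ext x
  rw [lintegral_gaussianReal_shift (f x) (g x) (F := fun y => F (x, y)) (by fun_prop)]
  congr 1
  ext e
  simp [obsRatio, mul_comm]

/-- With `δ = g x - f x`, the squared ratio is `exp(2δe - δ²)`, whose Gaussian mean is `exp(2δ² -
δ²)`. -/
theorem lintegral_obsRatio_sq (Q : Measure (Cube p)) [IsProbabilityMeasure Q]
    {f g : Cube p → ℝ} (hf : Measurable f) (hg : Measurable g) :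
    ∫⁻ z, obsRatio f g z ^ 2 ∂(obsLaw Q f) =
      ∫⁻ x, ENNReal.ofReal (Real.exp ((g x - f x) ^ 2)) ∂Q := by
  have hr := measurable_obsRatio hf hg
  rw [lintegral_obsLaw Q hf (by fun_prop)]
  congr 1
  ext x
  have h := lintegral_exp_mul_gaussianReal (2 * (g x - f x)) (-(g x - f x) ^ 2)
  rw [show (2 * (g x - f x)) ^ 2 / 2 + -(g x - f x) ^ 2 = (g x - f x) ^ 2 by ring] at h
  rw [← h]
  congr 1
  ext e
  simp only [obsRatio]
  rw [← ENNReal.ofReal_pow (by positivity), ← Real.exp_nat_mul]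
  congr 2
  push_cast
  ring

theorem exists_sample_likelihood_ratio (n : ℕ) (Q : Measure (Cube p)) [IsProbabilityMeasure Q]
    {f g : Cube p → ℝ} (hf : Measurable f) (hg : Measurable g) :
    ∃ ℓ : (Fin n → Cube p × ℝ) → ℝ≥0∞, Measurable ℓ ∧
      sampleLaw n Q g = (sampleLaw n Q f).withDensity ℓ ∧
      ∫⁻ z, ℓ z ^ 2 ∂(sampleLaw n Q f) =
        (∫⁻ x, ENNReal.ofReal (Real.exp ((g x - f x) ^ 2)) ∂Q) ^ n := by
  have hr := measurable_obsRatio hf hg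
  have h1 := isProbabilityMeasure_obsLaw Q hf
  have h2 := isProbabilityMeasure_obsLaw Q hg
  rw [obsLaw_eq_withDensity Q hf hg] at h2
  refine ⟨fun z => ∏ i, obsRatio f g (z i), by fun_prop, ?_, ?_⟩
  · unfold sampleLaw
    rw [obsLaw_eq_withDensity Q hf hg]
    exact pi_withDensity_eq _ hr
  · unfold sampleLaw
    simp_rw [← Finset.prod_pow]
    rw [lintegral_pi_prod _ (fun _ z => obsRatio f g z ^ 2) fun _ => by fun_prop]
    simp [lintegral_obsRatio_sq Q hf hg]

theorem isProbabilityMeasure_sampleLaw (n : ℕ) (Q : Measure (Cube p)) [IsProbabilityMeasure Q]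
    {f : Cube p → ℝ} (hf : Measurable f) : IsProbabilityMeasure (sampleLaw n Q f) := by
  have := isProbabilityMeasure_obsLaw Q hf
  unfold sampleLaw
  infer_instance

end SampleLikelihood

/-! ### Risk bounds for many hypotheses and for hypercubes. -/

section RiskBounds

variable {p n : ℕ} {Q : Measure (Cube p)}
  {est : (Fin n → Cube p × ℝ) → Cube p → ℝ}

theorem measurable_loss [IsProbabilityMeasure Q] (hest : Measurable (Function.uncurry est)) {f : Cube p → ℝ}
    (hf : Measurable f) (U : Set (Cube p)) :
    Measurable fun z => ∫⁻ x in U, ENNReal.ofReal ((est z x - f x) ^ 2) ∂Q := by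
  have h : Measurable fun w : (Fin n → Cube p × ℝ) × Cube p =>
      ENNReal.ofReal ((est w.1 w.2 - f w.2) ^ 2) := by
    have : Measurable fun w : (Fin n → Cube p × ℝ) × Cube p => est w.1 w.2 := hest
    fun_prop
  exact h.lintegral_prod_right'

theorem lintegral_sq_sub_le (hest : Measurable (Function.uncurry est)) {f g : Cube p → ℝ}
    (hf : Measurable f) (U : Set (Cube p)) (z) :
    ∫⁻ x in U, ENNReal.ofReal ((f x - g x) ^ 2) ∂Q ≤
      2 * (∫⁻ x in U, ENNReal.ofReal ((est z x - f x) ^ 2) ∂Q +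
        ∫⁻ x in U, ENNReal.ofReal ((est z x - g x) ^ 2) ∂Q) := by
  have hm : Measurable (est z) := hest.of_uncurry_left
  rw [← lintegral_add_left (by fun_prop), ← lintegral_const_mul' _ _ (by simp)]
  refine lintegral_mono fun x => ?_
  rw [← ENNReal.ofReal_add (by positivity) (by positivity), ← ENNReal.ofReal_ofNat,
    ← ENNReal.ofReal_mul (by norm_num)]
  apply ENNReal.ofReal_le_ofReal
  nlinarith [sq_nonneg ((est z x - f x) + (est z x - g x))]

/-- The loss is localised to `U` so that the losses on disjoint bump supports can later be added. -/
theorem two_point_risk [IsProbabilityMeasure Q] (hest : Measurable (Function.uncurry est)) {f g : Cube p → ℝ}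
    (hf : Measurable f) (hg : Measurable g) (U : Set (Cube p)) {E : ℝ} (hE0 : 0 ≤ E)
    (hE : (∫⁻ x, ENNReal.ofReal (Real.exp ((g x - f x) ^ 2)) ∂Q) ^ n ≤ ENNReal.ofReal E)
    {s : ℝ≥0∞} (hs : s ≤ ∫⁻ x in U, ENNReal.ofReal ((f x - g x) ^ 2) ∂Q) :
    s / 2 * ENNReal.ofReal (1 / (1 + E)) ≤
      ∫⁻ z, ∫⁻ x in U, ENNReal.ofReal ((est z x - f x) ^ 2) ∂Q ∂(sampleLaw n Q f) +
      ∫⁻ z, ∫⁻ x in U, ENNReal.ofReal ((est z x - g x) ^ 2) ∂Q ∂(sampleLaw n Q g) := by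
  obtain ⟨ℓ, hℓ, hlaw, hsq⟩ := exists_sample_likelihood_ratio n Q hf hg
  have hg1 := isProbabilityMeasure_sampleLaw n Q hg
  rw [hlaw] at hg1 ⊢
  refine two_point_bound hℓ ?_ hE0 (hsq.trans_le hE) (measurable_loss hest hf U)
    (measurable_loss hest hg U) fun z => ?_
  · have := hg1.measure_univ
    rwa [withDensity_apply _ MeasurableSet.univ, setLIntegral_univ] at this
  · refine ENNReal.div_le_of_le_mul' ?_
    exact hs.trans (lintegral_sq_sub_le hest hf U z)

/-- Lower bound for the worst-case risk over finitely many separated, uniformly small functions. -/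
theorem multiple_hypotheses_risk [IsProbabilityMeasure Q] (hest : Measurable (Function.uncurry est))
    {ι : Type*} [Fintype ι] [Nonempty ι] {f : ι → Cube p → ℝ} (hf : ∀ i, Measurable (f i))
    {τ D : ℝ} (hτ : ∀ i x, |f i x| ≤ τ)
    (hn : Real.exp (n * τ ^ 2) ≤ Fintype.card ι / 16) (hD : 0 ≤ D)
    (hsep : ∀ i j, i ≠ j → ENNReal.ofReal D ≤ ∫⁻ x, ENNReal.ofReal ((f i x - f j x) ^ 2) ∂Q)
    {F : Set (Cube p → ℝ)} (hF : ∀ i, f i ∈ F) :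
    ENNReal.ofReal (D / 8) ≤ ⨆ f ∈ F, l2Risk n Q est f := by
  rcases hD.eq_or_lt with rfl | hD
  · simp
  set B := ⨆ f ∈ F, l2Risk n Q est f with hB
  by_cases hBtop : B = ∞
  · rw [hBtop]; exact le_top
  set N := Fintype.card ι with hN
  have hN0 : 0 < N := Fintype.card_pos
  have hNr : (0 : ℝ) < N := by exact_mod_cast hN0
  set loss : ι → (Fin n → Cube p × ℝ) → ℝ≥0∞ :=
    fun i z => ∫⁻ x, ENNReal.ofReal ((est z x - f i x) ^ 2) ∂Q with hloss
  have hlm : ∀ i, Measurable (loss i) := fun i => by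
    have := measurable_loss (Q := Q) hest (hf i) Set.univ
    simpa [hloss] using this
  set P0 := sampleLaw n Q (fun _ => 0) with hP0
  have : IsProbabilityMeasure P0 := isProbabilityMeasure_sampleLaw n Q measurable_const
  choose ℓ hℓ hlaw hsq using fun i =>
    exists_sample_likelihood_ratio n Q (f := fun _ => 0) measurable_const (hf i)
  have hsq' : ∀ i, ∫⁻ z, ℓ i z ^ 2 ∂P0 ≤ ENNReal.ofReal (N / 16) := by
    intro i
    rw [hsq]
    calc (∫⁻ x, ENNReal.ofReal (Real.exp ((f i x - 0) ^ 2)) ∂Q) ^ n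
        ≤ (∫⁻ _, ENNReal.ofReal (Real.exp (τ ^ 2)) ∂Q) ^ n := by
          have hb : ∀ x, (f i x - 0) ^ 2 ≤ τ ^ 2 := fun x => by
            rw [sub_zero]
            exact sq_le_sq' (by linarith [neg_abs_le (f i x), hτ i x])
              ((le_abs_self _).trans (hτ i x))
          exact pow_le_pow_left₀ zero_le (lintegral_mono fun x =>
            ENNReal.ofReal_le_ofReal (Real.exp_le_exp.2 (hb x))) n
      _ = ENNReal.ofReal (Real.exp (n * τ ^ 2)) := by
          rw [lintegral_const, measure_univ, mul_one, ← ENNReal.ofReal_pow (by positivity),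
            ← Real.exp_nat_mul]
      _ ≤ _ := ENNReal.ofReal_le_ofReal hn
  set S : ι → Set (Fin n → Cube p × ℝ) := fun i => {z | loss i z < ENNReal.ofReal (D / 4)} with hS
  have hSm : ∀ i, MeasurableSet (S i) := fun i => measurableSet_lt (hlm i) measurable_const
  have hdisj : Pairwise fun i j => Disjoint (S i) (S j) := by
    intro i j hij
    rw [Set.disjoint_left]
    intro z hi hj
    have h1 := (hsep i j hij).trans (by
      have := lintegral_sq_sub_le (Q := Q) (g := f j) hest (hf i) Set.univ z
      simpa using this)
    have h2 : loss i z + loss j z < ENNReal.ofReal (D / 4) + ENNReal.ofReal (D / 4) :=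
      ENNReal.add_lt_add hi hj
    rw [← ENNReal.ofReal_add (by positivity) (by positivity)] at h2
    have h3 : 2 * (loss i z + loss j z) < 2 * ENNReal.ofReal (D / 4 + D / 4) :=
      (ENNReal.mul_lt_mul_iff_right two_ne_zero ENNReal.ofNat_ne_top).2 h2
    rw [← ENNReal.ofReal_ofNat, ← ENNReal.ofReal_mul (by norm_num)] at h3
    rw [show (2 : ℝ) * (D / 4 + D / 4) = D by ring] at h3
    rw [ENNReal.ofReal_ofNat] at h3
    exact absurd (h1.trans_lt h3) (lt_irrefl _)
  -- With `K = N/4` both terms of the bound equal `N/4`: on average `S i` has probability at most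
  -- 1/2, which leaves a risk of `D/4 · 1/2`.
  have hsum := sum_disjoint_events_le hℓ hsq' hSm hdisj
    (K := ENNReal.ofReal (N / 4)) (by simpa using hNr) (by simp)
  have hlaw' : ∀ i, P0.withDensity (ℓ i) = sampleLaw n Q (f i) := fun i => (hlaw i).symm
  simp_rw [hlaw'] at hsum
  have hval : ENNReal.ofReal (N / 4) +
      Fintype.card ι * ((ENNReal.ofReal (N / 4))⁻¹ * ENNReal.ofReal (N / 16)) =
      ENNReal.ofReal (N / 2) := by
    rw [← hN, ← ENNReal.ofReal_inv_of_pos (by positivity), ← ENNReal.ofReal_mul (by positivity),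
      ← ENNReal.ofReal_natCast N, ← ENNReal.ofReal_mul (by positivity),
      ← ENNReal.ofReal_add (by positivity) (by positivity)]
    congr 1
    field_simp
    norm_num
  rw [hval] at hsum
  have hone : ∀ i, ENNReal.ofReal (D / 4) ≤
      ENNReal.ofReal (D / 4) * sampleLaw n Q (f i) (S i) + B := by
    intro i
    have := isProbabilityMeasure_sampleLaw n Q (hf i)
    have h1 : ENNReal.ofReal (D / 4) * sampleLaw n Q (f i) (S i)ᶜ ≤ B := by
      have h2 := mul_meas_ge_le_lintegral (μ := sampleLaw n Q (f i)) (hlm i) (ENNReal.ofReal (D / 4))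
      have h3 : (S i)ᶜ = {z | ENNReal.ofReal (D / 4) ≤ loss i z} := by
        ext z; simp [hS]
      rw [h3]
      refine h2.trans ?_
      exact le_iSup₂ (f := fun f (_ : f ∈ F) => l2Risk n Q est f) (f i) (hF i)
    calc ENNReal.ofReal (D / 4) = ENNReal.ofReal (D / 4) *
          (sampleLaw n Q (f i) (S i) + sampleLaw n Q (f i) (S i)ᶜ) := by
          rw [measure_add_measure_compl (hSm i), measure_univ, mul_one]
      _ ≤ _ := by rw [mul_add]; gcongr
  have htot : N * ENNReal.ofReal (D / 4) ≤ ENNReal.ofReal (D / 4) * ENNReal.ofReal (N / 2) + N * B := by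
    calc N * ENNReal.ofReal (D / 4) = ∑ _i : ι, ENNReal.ofReal (D / 4) := by simp [hN]
      _ ≤ ∑ i, (ENNReal.ofReal (D / 4) * sampleLaw n Q (f i) (S i) + B) :=
          Finset.sum_le_sum fun i _ => hone i
      _ = ENNReal.ofReal (D / 4) * ∑ i, sampleLaw n Q (f i) (S i) + N * B := by
          rw [Finset.sum_add_distrib, Finset.mul_sum]; simp [hN]
      _ ≤ _ := by gcongr
  rw [← ENNReal.ofReal_toReal hBtop] at htot ⊢
  rw [← ENNReal.ofReal_natCast N, ← ENNReal.ofReal_mul (by positivity),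
    ← ENNReal.ofReal_mul (by positivity), ← ENNReal.ofReal_mul (by positivity),
    ← ENNReal.ofReal_add (by positivity) (by positivity),
    ENNReal.ofReal_le_ofReal_iff (by positivity)] at htot
  apply ENNReal.ofReal_le_ofReal
  have : N * (D / 8) ≤ N * B.toReal := by linarith
  exact le_of_mul_le_mul_left this hNr

/-- Uses `exp u ≤ 1 + 2u` on `[0,1]`, then `(1 + v)ⁿ ≤ exp(nv)`. Keeping the mass of the support in
the exponent allows summation over disjoint bumps. -/
theorem lintegral_exp_sq_pow_le [IsProbabilityMeasure Q] {φ : Cube p → ℝ} (hφ : Measurable φ) {τ : ℝ} (hτ1 : τ ≤ 1)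
    (h0 : ∀ x, 0 ≤ φ x) (hτ : ∀ x, φ x ≤ τ) :
    (∫⁻ x, ENNReal.ofReal (Real.exp (φ x ^ 2)) ∂Q) ^ n ≤
      ENNReal.ofReal (Real.exp (2 * n * τ ^ 2 * Q.real {x | φ x ≠ 0})) := by
  have hU : MeasurableSet {x | φ x ≠ 0} := hφ (measurableSet_singleton 0).compl
  have h1 : ∫⁻ x, ENNReal.ofReal (Real.exp (φ x ^ 2)) ∂Q ≤
      ENNReal.ofReal (1 + 2 * τ ^ 2 * Q.real {x | φ x ≠ 0}) := by
    calc ∫⁻ x, ENNReal.ofReal (Real.exp (φ x ^ 2)) ∂Q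
        ≤ ∫⁻ x, (1 + {x | φ x ≠ 0}.indicator (fun _ => ENNReal.ofReal (2 * τ ^ 2)) x) ∂Q := by
          refine lintegral_mono fun x => ?_
          by_cases hx : φ x = 0
          · simp [hx]
          · rw [Set.indicator_of_mem (by exact hx), ← ENNReal.ofReal_one,
              ← ENNReal.ofReal_add zero_le_one (by positivity)]
            apply ENNReal.ofReal_le_ofReal
            have hs : φ x ^ 2 ≤ τ ^ 2 := pow_le_pow_left₀ (h0 x) (hτ x) 2
            have hs1 : φ x ^ 2 ≤ 1 := pow_le_one₀ (h0 x) ((hτ x).trans hτ1)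
            have hb := Real.abs_exp_sub_one_le (x := φ x ^ 2) (by rwa [abs_of_nonneg (sq_nonneg _)])
            rw [abs_of_nonneg (sq_nonneg (φ x))] at hb
            linarith [le_abs_self (Real.exp (φ x ^ 2) - 1)]
      _ = 1 + ENNReal.ofReal (2 * τ ^ 2) * Q {x | φ x ≠ 0} := by
          rw [lintegral_add_left measurable_const, lintegral_indicator hU, setLIntegral_const]
          simp
      _ = _ := by
          rw [← ofReal_measureReal, ← ENNReal.ofReal_mul (by positivity), ← ENNReal.ofReal_one,
            ← ENNReal.ofReal_add zero_le_one (by positivity)]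
  calc _ ≤ ENNReal.ofReal (1 + 2 * τ ^ 2 * Q.real {x | φ x ≠ 0}) ^ n := by gcongr
    _ ≤ ENNReal.ofReal (Real.exp (2 * τ ^ 2 * Q.real {x | φ x ≠ 0})) ^ n := by
        gcongr; linarith [Real.add_one_le_exp (2 * τ ^ 2 * Q.real {x | φ x ≠ 0})]
    _ = _ := by
        rw [← ENNReal.ofReal_pow (by positivity), ← Real.exp_nat_mul]
        congr 2; ring

/-- Lower bound for the worst-case risk over a hypercube of sums of bumps with disjoint supports. -/
theorem hypercube_risk [IsProbabilityMeasure Q] (hest : Measurable (Function.uncurry est))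
    {κ : Type*} [Fintype κ] [DecidableEq κ] {φ : κ → Cube p → ℝ} (hφ : ∀ k, Measurable (φ k))
    {τ c : ℝ} (hτ1 : τ ≤ 1) (h0 : ∀ k x, 0 ≤ φ k x) (hτ : ∀ k x, φ k x ≤ τ)
    (hdisj : ∀ k l x, k ≠ l → φ k x = 0 ∨ φ l x = 0)
    (hn : n * τ ^ 2 ≤ c * Fintype.card κ) {s : ℝ≥0∞}
    (hs : ∀ k, s ≤ ∫⁻ x, ENNReal.ofReal (φ k x ^ 2) ∂Q)
    {F : Set (Cube p → ℝ)}
    (hF : ∀ ω : κ → Bool, (fun x => ∑ k, if ω k then φ k x else 0) ∈ F) :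
    ENNReal.ofReal (Fintype.card κ * Real.exp (-(2 * c)) / 8) * s ≤
      ⨆ f ∈ F, l2Risk n Q est f := by
  classical
  set B := ⨆ f ∈ F, l2Risk n Q est f with hB
  set f : (κ → Bool) → Cube p → ℝ := fun ω x => ∑ k, if ω k then φ k x else 0 with hf
  have hfm : ∀ ω, Measurable (f ω) := by
    intro ω
    refine Finset.measurable_sum _ fun k _ => ?_
    by_cases h : ω k <;> simp [h, hφ k]
  set U : κ → Set (Cube p) := fun k => {x | φ k x ≠ 0} with hU
  have hUm : ∀ k, MeasurableSet (U k) := fun k => hφ k (measurableSet_singleton 0).compl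
  have hUd : Pairwise fun k l => Disjoint (U k) (U l) := by
    intro k l hkl
    rw [Set.disjoint_left]
    intro x hk hl
    rcases hdisj k l x hkl with h | h
    · exact hk h
    · exact hl h
  set T : (κ → Bool) → κ → ℝ≥0∞ := fun ω k =>
    ∫⁻ z, ∫⁻ x in U k, ENNReal.ofReal ((est z x - f ω x) ^ 2) ∂Q ∂(sampleLaw n Q (f ω)) with hT
  have hTB : ∀ ω, ∑ k, T ω k ≤ B := by
    intro ω
    rw [hT, ← lintegral_finsetSum _ fun k _ => measurable_loss hest (hfm ω) (U k)]
    refine le_trans ?_ (le_iSup₂ (f := fun f (_ : f ∈ F) => l2Risk n Q est f) (f ω) (hF ω))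
    refine lintegral_mono fun z => ?_
    rw [← tsum_fintype (L := .unconditional _), ← lintegral_iUnion hUm hUd]
    exact setLIntegral_le_lintegral _ _
  set r : κ → ℝ := fun k => Real.exp (-(2 * n * τ ^ 2 * Q.real (U k))) with hr
  set flip : κ → (κ → Bool) → (κ → Bool) := fun k ω => Function.update ω k (!ω k) with hflip
  have hinv : ∀ k, Function.Involutive (flip k) := by
    intro k ω
    ext l
    by_cases h : l = k
    · subst h; simp [hflip]
    · simp [hflip, h]
  have hdiff : ∀ ω k x, (f (flip k ω) x - f ω x) ^ 2 = φ k x ^ 2 := by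
    intro ω k x
    have h1 : f (flip k ω) x - f ω x = if ω k then - φ k x else φ k x := by
      simp only [hf]
      rw [← Finset.sum_sub_distrib, Finset.sum_eq_single k]
      · cases h : ω k <;> simp [hflip, h]
      · intro l _ hl
        simp [hflip, hl]
      · simp
    rw [h1]
    split_ifs <;> ring
  -- Flipping coordinate `k` changes the function by `±φ k` only. With `E = exp y`, `1/(1 + E) ≥
  -- exp(-y)/2` accounts for the passage from `s/2` to `s/4`.
  have hpair : ∀ ω k, s / 4 * ENNReal.ofReal (r k) ≤ T ω k + T (flip k ω) k := by
    intro ω k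
    set y := 2 * n * τ ^ 2 * Q.real (U k) with hy
    have hy0 : 0 ≤ y := by positivity
    have h := two_point_risk (Q := Q) (n := n) hest (hfm ω) (hfm (flip k ω)) (U k)
      (E := Real.exp y) (by positivity) (by
        simp_rw [hdiff]
        exact lintegral_exp_sq_pow_le (hφ k) hτ1 (h0 k) (hτ k)) (s := s) (by
        have : ∀ x, (f ω x - f (flip k ω) x) ^ 2 = φ k x ^ 2 := fun x => by
          rw [← hdiff ω k x]; ring
        simp_rw [this]
        refine (hs k).trans ?_
        rw [← lintegral_indicator (hUm k)]
        refine lintegral_mono fun x => ?_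
        by_cases hx : φ k x = 0
        · simp [hx]
        · rw [Set.indicator_of_mem (by exact hx)])
    refine le_trans ?_ h
    have h4 : s / 4 = s / 2 * ENNReal.ofReal (1 / 2) := by
      rw [ENNReal.ofReal_div_of_pos (by norm_num), div_eq_mul_inv, div_eq_mul_inv, div_eq_mul_inv,
        ENNReal.ofReal_one, one_mul, ENNReal.ofReal_ofNat, mul_assoc,
        ← ENNReal.mul_inv (by simp) (by simp)]
      norm_num
    rw [h4, mul_assoc, ← ENNReal.ofReal_mul (by norm_num)]
    gcongr
    rw [hr]
    simp only
    rw [← hy, Real.exp_neg, ← one_div, one_div_mul_one_div]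
    apply one_div_le_one_div_of_le (by positivity)
    linarith [Real.one_le_exp hy0]
  have hk : ∀ k, Fintype.card (κ → Bool) * (s / 4 * ENNReal.ofReal (r k)) ≤ 2 * ∑ ω, T ω k := by
    intro k
    calc Fintype.card (κ → Bool) * (s / 4 * ENNReal.ofReal (r k))
        = ∑ _ω : κ → Bool, s / 4 * ENNReal.ofReal (r k) := by simp
      _ ≤ ∑ ω, (T ω k + T (flip k ω) k) := Finset.sum_le_sum fun ω _ => hpair ω k
      _ = _ := by
        rw [Finset.sum_add_distrib, two_mul]
        congr 1
        exact Equiv.sum_comp (hinv k).toPerm (fun ω => T ω k)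
  have htot : Fintype.card (κ → Bool) * ∑ k, s / 4 * ENNReal.ofReal (r k) ≤
      Fintype.card (κ → Bool) * (2 * B) := by
    calc _ = ∑ k, Fintype.card (κ → Bool) * (s / 4 * ENNReal.ofReal (r k)) := Finset.mul_sum ..
      _ ≤ ∑ k, 2 * ∑ ω, T ω k := Finset.sum_le_sum fun k _ => hk k
      _ = 2 * ∑ ω, ∑ k, T ω k := by rw [← Finset.mul_sum, Finset.sum_comm]
      _ ≤ 2 * ∑ _ω : κ → Bool, B := by gcongr with ω; exact hTB ω
      _ = _ := by simp; ring
  have hcard0 : (Fintype.card (κ → Bool) : ℝ≥0∞) ≠ 0 := by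
    exact_mod_cast Fintype.card_ne_zero
  have htot2 := (ENNReal.mul_le_mul_iff_right hcard0 (ENNReal.natCast_ne_top _)).1 htot
  have hQsum : ∑ k, Q.real (U k) ≤ 1 := by
    have h1 : ∑ k, Q (U k) ≤ 1 := by
      rw [← tsum_fintype (L := .unconditional _), ← measure_iUnion hUd hUm]
      exact prob_le_one
    have h2 := ENNReal.toReal_mono ENNReal.one_ne_top h1
    rw [ENNReal.toReal_sum fun k _ => measure_ne_top _ _] at h2
    simpa [Measure.real] using h2
  -- The tangent of `exp` at `-2c` makes the bound linear in `Q(U k)`; only the total mass, at most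
  -- one, then matters, not the mass of each support.
  have hrsum : Fintype.card κ * Real.exp (-(2 * c)) ≤ ∑ k, r k := by
    have h1 : ∀ k, Real.exp (-(2 * c)) * (1 + 2 * c - 2 * n * τ ^ 2 * Q.real (U k)) ≤ r k := by
      intro k
      have h2 := Real.add_one_le_exp (2 * c - 2 * n * τ ^ 2 * Q.real (U k))
      calc _ ≤ Real.exp (-(2 * c)) * Real.exp (2 * c - 2 * n * τ ^ 2 * Q.real (U k)) := by
            gcongr; linarith
        _ = r k := by rw [← Real.exp_add, hr]; congr 1; ring
    refine le_trans ?_ (Finset.sum_le_sum fun k _ => h1 k)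
    rw [← Finset.mul_sum, mul_comm]
    gcongr
    rw [Finset.sum_sub_distrib, ← Finset.mul_sum]
    simp only [Finset.sum_const, Finset.card_univ, nsmul_eq_mul]
    have : 2 * n * τ ^ 2 * ∑ k, Q.real (U k) ≤ 2 * n * τ ^ 2 * 1 := by gcongr
    linarith
  rw [← Finset.mul_sum, ← ENNReal.ofReal_sum_of_nonneg fun k _ => (Real.exp_pos _).le] at htot2
  have h8 : ENNReal.ofReal (Fintype.card κ * Real.exp (-(2 * c)) / 8) * s =
      (s / 4 * ENNReal.ofReal (Fintype.card κ * Real.exp (-(2 * c)))) / 2 := by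
    rw [ENNReal.ofReal_div_of_pos (by norm_num)]
    have h42 : (ENNReal.ofReal 8)⁻¹ = 4⁻¹ * 2⁻¹ := by
      rw [← ENNReal.mul_inv (by simp) (by simp), ENNReal.ofReal_ofNat]
      norm_num
    simp only [div_eq_mul_inv]
    rw [h42]
    ring
  rw [h8]
  refine ENNReal.div_le_of_le_mul' (le_trans ?_ htot2)
  gcongr

end RiskBounds

/-! ### Tent functions and elementary Hölder estimates. -/

section Tent

/-- The tent function supported on `[0,1]`. -/
noncomputable def tent (u : ℝ) : ℝ := max 0 (min u (1 - u))

theorem continuous_tent : Continuous tent := by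
  unfold tent; fun_prop

theorem tent_nonneg (u : ℝ) : 0 ≤ tent u := le_max_left _ _

theorem tent_le_one (u : ℝ) : tent u ≤ 1 := by
  unfold tent
  rcases le_total u 1 with h | h
  · exact max_le zero_le_one ((min_le_left _ _).trans h)
  · exact max_le zero_le_one ((min_le_right _ _).trans (by linarith))

theorem abs_tent_sub_le (u v : ℝ) : |tent u - tent v| ≤ |u - v| := by
  unfold tent
  refine (abs_max_sub_max_le_max _ _ _ _).trans ?_
  rw [sub_self, abs_zero, max_eq_right (abs_nonneg _)]
  refine (abs_min_sub_min_le_max _ _ _ _).trans ?_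
  rw [show 1 - u - (1 - v) = -(u - v) by ring, abs_neg, max_self]

theorem mem_Ioo_of_tent_ne_zero {u : ℝ} (h : tent u ≠ 0) : 0 < u ∧ u < 1 := by
  have h1 : 0 < min u (1 - u) := by
    by_contra hc
    exact h (max_eq_left (not_lt.1 hc))
  rw [lt_min_iff] at h1
  exact ⟨h1.1, by linarith [h1.2]⟩

theorem quarter_le_tent {u : ℝ} (h1 : 1 / 4 ≤ u) (h2 : u ≤ 3 / 4) : 1 / 4 ≤ tent u :=
  le_max_of_le_right (le_min h1 (by linarith))

/-- A Lipschitz bound serves for small `x`, the bounded range for large `x`: this makes 1-Lipschitz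
functions into `[0,1]` Hölder of every order in `(0,1]`. -/
theorem abs_sub_le_rpow_of_unit {a b x α : ℝ} (ha0 : 0 ≤ a) (ha1 : a ≤ 1) (hb0 : 0 ≤ b)
    (hb1 : b ≤ 1) (hx : |a - b| ≤ x) (hα0 : 0 < α) (hα1 : α ≤ 1) : |a - b| ≤ x ^ α := by
  rcases le_total x 1 with h | h
  · exact hx.trans (Real.self_le_rpow_of_le_one ((abs_nonneg _).trans hx) h hα1)
  · have h1 : |a - b| ≤ 1 := abs_sub_le_iff.2 ⟨by linarith, by linarith⟩
    exact h1.trans (Real.one_le_rpow h hα0.le)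

theorem abs_prod_sub_prod_le {ι : Type*} (s : Finset ι) {a b : ι → ℝ} (ha0 : ∀ i, 0 ≤ a i)
    (ha1 : ∀ i, a i ≤ 1) (hb0 : ∀ i, 0 ≤ b i) (hb1 : ∀ i, b i ≤ 1) :
    |∏ i ∈ s, a i - ∏ i ∈ s, b i| ≤ ∑ i ∈ s, |a i - b i| := by
  classical
  induction s using Finset.induction_on with
  | empty => simp
  | insert i s hi ih =>
    rw [Finset.prod_insert hi, Finset.prod_insert hi, Finset.sum_insert hi]
    have h : a i * ∏ x ∈ s, a x - b i * ∏ x ∈ s, b x =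
        (a i - b i) * ∏ x ∈ s, a x + b i * (∏ x ∈ s, a x - ∏ x ∈ s, b x) := by ring
    rw [h]
    refine (abs_add_le _ _).trans ?_
    rw [abs_mul, abs_mul, abs_of_nonneg (hb0 i),
      abs_of_nonneg (Finset.prod_nonneg fun j _ => ha0 j)]
    refine add_le_add (mul_le_of_le_one_right (abs_nonneg _)
      (Finset.prod_le_one (fun j _ => ha0 j) fun j _ => ha1 j)) ?_
    exact (mul_le_of_le_one_left (abs_nonneg _) (hb1 i)).trans ih

end Tent

/-! ### Bumps on a single cell. -/

section Bump

variable {d : ℕ}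

/-- The bump of height `τ` on the cell `∏ j, [o j, o j + w j]`. -/
noncomputable def cellBump (τ : ℝ) (o w : Fin d → ℝ) (x : Cube d) : ℝ :=
  τ * ∏ j, tent (((x j : ℝ) - o j) / w j)

variable {τ : ℝ} {o w : Fin d → ℝ}

theorem continuous_cellBump : Continuous (cellBump τ o w) := by
  unfold cellBump
  refine continuous_const.mul (continuous_finsetProd _ fun j _ => continuous_tent.comp ?_)
  fun_prop

theorem cellBump_nonneg (hτ : 0 ≤ τ) (x : Cube d) : 0 ≤ cellBump τ o w x :=
  mul_nonneg hτ (Finset.prod_nonneg fun _ _ => tent_nonneg _)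

theorem cellBump_le (hτ : 0 ≤ τ) (x : Cube d) : cellBump τ o w x ≤ τ :=
  mul_le_of_le_one_right hτ
    (Finset.prod_le_one (fun _ _ => tent_nonneg _) fun _ _ => tent_le_one _)

theorem mem_cell_of_cellBump_ne_zero (hw : ∀ j, 0 < w j) {x : Cube d}
    (h : cellBump τ o w x ≠ 0) (j : Fin d) : o j < x j ∧ (x j : ℝ) < o j + w j := by
  have h1 := mem_Ioo_of_tent_ne_zero
    (Finset.prod_ne_zero_iff.1 (right_ne_zero_of_mul h) j (Finset.mem_univ j))
  rw [lt_div_iff₀ (hw j), div_lt_iff₀ (hw j)] at h1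
  constructor <;> linarith [h1.1, h1.2]

theorem le_cellBump (hτ : 0 ≤ τ) (hw : ∀ j, 0 < w j) {x : Cube d}
    (h : ∀ j, o j + w j / 4 ≤ x j ∧ (x j : ℝ) ≤ o j + 3 * w j / 4) :
    τ * (1 / 4) ^ d ≤ cellBump τ o w x := by
  unfold cellBump
  gcongr
  calc (1 / 4 : ℝ) ^ d = ∏ _j : Fin d, (1 / 4 : ℝ) := by simp
    _ ≤ _ := Finset.prod_le_prod (fun _ _ => by norm_num) fun j _ => by
      apply quarter_le_tent
      · rw [le_div_iff₀ (hw j)]; linarith [(h j).1]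
      · rw [div_le_iff₀ (hw j)]; linarith [(h j).2]

/-- Rescaling the `j`-th tent by `w j` gives the Hölder constant `τ / w j ^ α j`, and the width
condition says precisely that this is at most `L`. -/
theorem abs_cellBump_sub_le {L : ℝ} (hL : 0 < L) (hτ : 0 < τ) {α : Fin d → ℝ}
    (hα : ∀ j, 0 < α j ∧ α j ≤ 1) (hw : ∀ j, (τ / L) ^ (α j)⁻¹ ≤ w j) (x y : Cube d) :
    |cellBump τ o w x - cellBump τ o w y| ≤ L * ∑ j, |(x j : ℝ) - (y j : ℝ)| ^ (α j) := by
  have hτL : 0 < τ / L := by positivity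
  have hw0 : ∀ j, 0 < w j := fun j => (Real.rpow_pos_of_pos hτL _).trans_le (hw j)
  unfold cellBump
  rw [← mul_sub, abs_mul, abs_of_pos hτ]
  refine (mul_le_mul_of_nonneg_left (abs_prod_sub_prod_le _ (fun _ => tent_nonneg _)
    (fun _ => tent_le_one _) (fun _ => tent_nonneg _) fun _ => tent_le_one _) hτ.le).trans ?_
  rw [Finset.mul_sum, Finset.mul_sum]
  refine Finset.sum_le_sum fun j _ => ?_
  have h1 := abs_sub_le_rpow_of_unit (tent_nonneg (((x j : ℝ) - o j) / w j)) (tent_le_one _)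
    (tent_nonneg (((y j : ℝ) - o j) / w j)) (tent_le_one _) (abs_tent_sub_le _ _)
    (hα j).1 (hα j).2
  rw [← sub_div, sub_sub_sub_cancel_right, abs_div, abs_of_pos (hw0 j),
    Real.div_rpow (abs_nonneg _) (hw0 j).le] at h1
  have h2 : τ / L ≤ w j ^ α j := by
    calc τ / L = ((τ / L) ^ (α j)⁻¹) ^ α j := by
          rw [← Real.rpow_mul hτL.le, inv_mul_cancel₀ (hα j).1.ne', Real.rpow_one]
      _ ≤ _ := Real.rpow_le_rpow (by positivity) (hw j) (hα j).1.le
  have hwp : 0 < w j ^ α j := Real.rpow_pos_of_pos (hw0 j) _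
  calc _ ≤ τ * (|(x j : ℝ) - y j| ^ α j / w j ^ α j) := by gcongr
    _ = τ / w j ^ α j * |(x j : ℝ) - y j| ^ α j := by ring
    _ ≤ L * |(x j : ℝ) - y j| ^ α j := by
        gcongr
        rw [div_le_iff₀ hwp]
        rw [div_le_iff₀ hL] at h2
        linarith

theorem lintegral_cellBump_sq_ge (hτ : 0 ≤ τ) (hw : ∀ j, 0 < w j) (ho : ∀ j, 0 ≤ o j)
    (how : ∀ j, o j + w j ≤ 1) :
    ENNReal.ofReal ((τ * (1 / 4) ^ d) ^ 2 * ∏ j, (w j / 2)) ≤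
      ∫⁻ x, ENNReal.ofReal (cellBump τ o w x ^ 2) := by
  let lo : Fin d → I := fun j => ⟨o j + w j / 4, by
    constructor <;> linarith [hw j, ho j, how j]⟩
  let hi : Fin d → I := fun j => ⟨o j + 3 * w j / 4, by
    constructor <;> linarith [hw j, ho j, how j]⟩
  have hvol : volume (Set.univ.pi fun j => Set.Icc (lo j) (hi j)) =
      ENNReal.ofReal (∏ j, (w j / 2)) := by
    rw [volume_pi_pi, ENNReal.ofReal_prod_of_nonneg fun j _ => by linarith [hw j]]
    refine Finset.prod_congr rfl fun j _ => ?_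
    rw [unitInterval.volume_Icc]
    congr 1
    simp only [lo, hi]
    ring
  rw [ENNReal.ofReal_mul (by positivity), ← hvol, ← setLIntegral_const]
  refine le_trans (setLIntegral_mono' (MeasurableSet.univ_pi fun j => measurableSet_Icc)
    fun x hx => ?_) (setLIntegral_le_lintegral _ _)
  apply ENNReal.ofReal_le_ofReal
  refine pow_le_pow_left₀ (by positivity) (le_cellBump hτ hw fun j => ?_) 2
  have := hx j trivial
  exact ⟨this.1, this.2⟩

end Bump

/-! ### Sums of functions with disjoint supports. -/

section DisjointSums

variable {κ X : Type*} [Fintype κ] {φ : κ → X → ℝ}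

/-- At most one term is nonzero at `x`; it is compared with the same term at `y`, the others there
being nonnegative. Hence no factor 2 is lost when `x` and `y` lie in different cells. -/
theorem disjoint_sum_le {B : ℝ} (hB : 0 ≤ B) (h0 : ∀ k x, 0 ≤ φ k x)
    (hdisj : ∀ k l x, k ≠ l → φ k x = 0 ∨ φ l x = 0) (ω : κ → Bool) {x y : X}
    (h : ∀ k, φ k x ≤ φ k y + B) :
    ∑ k, (if ω k then φ k x else 0) ≤ ∑ k, (if ω k then φ k y else 0) + B := by
  have hy0 : ∀ k, 0 ≤ (if ω k then φ k y else 0) := fun k => by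
    split_ifs
    · exact h0 k y
    · exact le_rfl
  by_cases hx : ∃ k, (if ω k then φ k x else 0) ≠ 0
  · obtain ⟨k, hk⟩ := hx
    have hω : ω k = true := by
      by_contra hc; simp [hc] at hk
    simp only [hω, if_true] at hk
    rw [Finset.sum_eq_single k]
    · have := Finset.single_le_sum (fun l _ => hy0 l) (Finset.mem_univ k)
      simp only [hω, if_true] at this ⊢
      linarith [h k]
    · intro l _ hl
      have := (hdisj l k x hl).resolve_right hk
      simp [this]
    · simp
  · push Not at hx
    rw [Finset.sum_eq_zero fun k _ => hx k]
    exact add_nonneg (Finset.sum_nonneg fun k _ => hy0 k) hB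

theorem abs_disjoint_sum_sub_le {B : ℝ} (hB : 0 ≤ B) (h0 : ∀ k x, 0 ≤ φ k x)
    (hdisj : ∀ k l x, k ≠ l → φ k x = 0 ∨ φ l x = 0) (ω : κ → Bool) {x y : X}
    (h : ∀ k, |φ k x - φ k y| ≤ B) :
    |∑ k, (if ω k then φ k x else 0) - ∑ k, (if ω k then φ k y else 0)| ≤ B := by
  have h1 := disjoint_sum_le hB h0 hdisj ω (x := x) (y := y)
    fun k => by linarith [(abs_le.1 (h k)).2]
  have h2 := disjoint_sum_le hB h0 hdisj ω (x := y) (y := x)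
    fun k => by linarith [(abs_le.1 (h k)).1]
  rw [abs_le]
  constructor <;> linarith

theorem abs_disjoint_sum_le {B : ℝ} (hB : 0 ≤ B) (h0 : ∀ k x, 0 ≤ φ k x)
    (hdisj : ∀ k l x, k ≠ l → φ k x = 0 ∨ φ l x = 0) (ω : κ → Bool) {x : X}
    (h : ∀ k, φ k x ≤ B) :
    |∑ k, (if ω k then φ k x else 0)| ≤ B := by
  have hpos : 0 ≤ ∑ k, (if ω k then φ k x else 0) := Finset.sum_nonneg fun k _ => by
    split_ifs
    · exact h0 k x
    · exact le_rfl
  rw [abs_of_nonneg hpos]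
  by_cases hx : ∃ k, (if ω k then φ k x else 0) ≠ 0
  · obtain ⟨k, hk⟩ := hx
    have hω : ω k = true := by
      by_contra hc; simp [hc] at hk
    simp only [hω, if_true] at hk
    rw [Finset.sum_eq_single k]
    · simpa [hω] using h k
    · intro l _ hl
      have := (hdisj l k x hl).resolve_right hk
      simp [this]
    · simp
  · push Not at hx
    rw [Finset.sum_eq_zero fun k _ => hx k]
    exact hB

end DisjointSums

/-! ### Box partitions and their grids of bumps. -/

section Boxes

variable {d : ℕ}

/-- `J` contains everything strictly between its infimum and supremum, and the endpoints carry no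
measure. -/
theorem exists_interval_of_ordConnected {J : Set I} (hJ : J.OrdConnected)
    (hlen : 0 < (volume J).toReal) :
    ∃ a : ℝ, 0 ≤ a ∧ a + (volume J).toReal ≤ 1 ∧
      ∀ x : I, a < x → (x : ℝ) < a + (volume J).toReal → x ∈ J := by
  set T : Set ℝ := Subtype.val '' J with hT
  have hvol : volume J = volume T := unitInterval.volume_apply
  have hne : T.Nonempty := by
    by_contra hc
    rw [Set.not_nonempty_iff_eq_empty] at hc
    rw [hvol, hc] at hlen
    simp at hlen
  have hT0 : ∀ t ∈ T, 0 ≤ t ∧ t ≤ 1 := by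
    rintro t ⟨x, -, rfl⟩
    exact x.2
  have hbb : BddBelow T := ⟨0, fun t ht => (hT0 t ht).1⟩
  have hba : BddAbove T := ⟨1, fun t ht => (hT0 t ht).2⟩
  set a := sInf T
  set b := sSup T
  have hab : a ≤ b := Real.sInf_le_sSup T hbb hba
  have hmem : ∀ x : ℝ, a < x → x < b → x ∈ T := by
    intro x hax hxb
    obtain ⟨t, ht, htx⟩ := exists_lt_of_csInf_lt hne hax
    obtain ⟨u, hu, hxu⟩ := exists_lt_of_lt_csSup hne hxb
    obtain ⟨t', ht', rfl⟩ := ht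
    obtain ⟨u', hu', rfl⟩ := hu
    exact ⟨⟨x, t'.2.1.trans htx.le, hxu.le.trans u'.2.2⟩, hJ.out ht' hu' ⟨htx.le, hxu.le⟩, rfl⟩
  have hvT : volume T = ENNReal.ofReal (b - a) := by
    apply le_antisymm
    · rw [← Real.volume_Icc]
      exact measure_mono fun t ht => ⟨csInf_le hbb ht, le_csSup hba ht⟩
    · rw [← Real.volume_Ioo]
      exact measure_mono fun t ht => hmem t ht.1 ht.2
  have hreal : (volume J).toReal = b - a := by
    rw [hvol, hvT, ENNReal.toReal_ofReal (by linarith)]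
  refine ⟨a, le_csInf hne fun t ht => (hT0 t ht).1, ?_, ?_⟩
  · rw [hreal]
    have : b ≤ 1 := csSup_le hne fun t ht => (hT0 t ht).2
    linarith
  · intro x hax hxb
    rw [hreal] at hxb
    obtain ⟨y, hy, hyx⟩ := hmem x hax (by linarith)
    rwa [← Subtype.ext hyx]

theorem projLen_univ_pi {J : Fin d → Set I} (hne : (Set.univ.pi J).Nonempty) (j : Fin d) :
    projLen (Set.univ.pi J) j = (volume (J j)).toReal := by
  have h : (fun x : Cube d => (x j : ℝ)) '' Set.univ.pi J = Subtype.val '' J j := by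
    rw [← Set.eval_image_univ_pi hne, Set.image_image]
  rw [projLen, h, ← unitInterval.volume_apply]

theorem IsBox.exists_corner {E : Set (Cube d)} (hE : IsBox E) (hd : 0 < d)
    (hlen : ∀ j, 0 < projLen E j) :
    MeasurableSet E ∧ (volume E).toReal = ∏ j, projLen E j ∧
      ∃ a : Fin d → ℝ, (∀ j, 0 ≤ a j) ∧ (∀ j, a j + projLen E j ≤ 1) ∧
        ∀ x : Cube d, (∀ j, a j < x j ∧ (x j : ℝ) < a j + projLen E j) → x ∈ E := by
  obtain ⟨J, hJ, rfl⟩ := hE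
  have hne : (Set.univ.pi J).Nonempty := by
    by_contra hc
    rw [Set.not_nonempty_iff_eq_empty] at hc
    have := hlen ⟨0, hd⟩
    rw [hc] at this
    simp [projLen] at this
  have hp := projLen_univ_pi hne
  refine ⟨MeasurableSet.univ_pi fun j => (hJ j).measurableSet, ?_, ?_⟩
  · rw [volume_pi_pi, ENNReal.toReal_prod]
    exact Finset.prod_congr rfl fun j _ => (hp j).symm
  · have h : ∀ j, ∃ a : ℝ, 0 ≤ a ∧ a + projLen (Set.univ.pi J) j ≤ 1 ∧
        ∀ x : I, a < x → (x : ℝ) < a + projLen (Set.univ.pi J) j → x ∈ J j := by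
      intro j
      rw [hp j]
      exact exists_interval_of_ordConnected (hJ j) (hp j ▸ hlen j)
    choose a ha0 ha1 ha using h
    exact ⟨a, ha0, ha1, fun x hx j _ => ha j (x j) (hx j).1 (hx j).2⟩

theorem IsBoxPartition.sum_prod_projLen {R : ℕ} {Xi : Fin R → Set (Cube d)}
    (hXi : IsBoxPartition Xi) (hd : 0 < d) (hlen : ∀ r j, 0 < projLen (Xi r) j) :
    ∑ r, ∏ j, projLen (Xi r) j = 1 := by
  have h := fun r => (hXi.isBox r).exists_corner hd (hlen r)
  have h1 : volume (⋃ r, Xi r) = ∑ r, volume (Xi r) := by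
    rw [measure_iUnion (fun r s hrs => hXi.disjoint r s hrs) fun r => (h r).1, tsum_fintype]
  rw [hXi.cover, measure_univ] at h1
  have h2 := congrArg ENNReal.toReal h1
  rw [ENNReal.toReal_sum fun r _ => measure_ne_top _ _, ENNReal.toReal_one] at h2
  rw [h2]
  exact Finset.sum_congr rfl fun r _ => (h r).2.1.symm

/-- The common harmonic mean gives `∏ j, a0 r j` the same value `v` in every box. Cells have volume
at most `2^d v` and together fill the cube, so there are at least `1/(2^d v)` of them. -/
theorem exists_bumps {R : ℕ} {Xi : Fin R → Set (Cube d)} (hXi : IsBoxPartition Xi) (hd : 0 < d)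
    {A : Fin R → Fin d → ℝ} {abar L τ : ℝ} (hA : A ∈ smoothnessTuples R d abar) (hL : 0 < L)
    (hτ : 0 < τ) (hlen : ∀ r j, (τ / L) ^ (A r j)⁻¹ ≤ projLen (Xi r) j) :
    ∃ (κ : Type) (_ : Fintype κ) (_ : DecidableEq κ) (φ : κ → Cube d → ℝ),
      (∀ k, Continuous (φ k)) ∧ (∀ k x, 0 ≤ φ k x) ∧ (∀ k x, φ k x ≤ τ) ∧
      (∀ k l x, k ≠ l → φ k x = 0 ∨ φ l x = 0) ∧
      1 ≤ 2 ^ d * (τ / L) ^ ((d : ℝ) / abar) * Fintype.card κ ∧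
      (∀ k, ENNReal.ofReal ((τ * (1 / 4) ^ d) ^ 2 * ((1 / 2) ^ d * (τ / L) ^ ((d : ℝ) / abar))) ≤
        ∫⁻ x, ENNReal.ofReal (φ k x ^ 2)) ∧
      ∀ ω : κ → Bool, (fun x => ∑ k, if ω k then φ k x else 0) ∈ piecewiseHolder L A Xi := by
  have hτL : 0 < τ / L := by positivity
  set a0 : Fin R → Fin d → ℝ := fun r j => (τ / L) ^ (A r j)⁻¹ with ha0
  have ha0pos : ∀ r j, 0 < a0 r j := fun r j => Real.rpow_pos_of_pos hτL _
  have hlpos : ∀ r j, 0 < projLen (Xi r) j := fun r j => (ha0pos r j).trans_le (hlen r j)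
  have hv : ∀ r, ∏ j, a0 r j = (τ / L) ^ ((d : ℝ) / abar) := by
    intro r
    rw [ha0, ← Real.rpow_sum_of_pos hτL]
    congr 1
    have := (hA r).2
    have hd' : (d : ℝ) ≠ 0 := by exact_mod_cast hd.ne'
    rw [div_eq_mul_inv, this, mul_inv_cancel_left₀ hd']
  choose hmeas hvol a hapos ha1 hain using fun r => (hXi.isBox r).exists_corner hd (hlpos r)
  -- Rounding down gives widths `w` between `a0` and `2 a0`: wide enough for the Hölder bound,
  -- narrow enough for the count.
  set N : Fin R → Fin d → ℕ := fun r j => ⌊projLen (Xi r) j / a0 r j⌋₊ with hN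
  have hN1 : ∀ r j, 1 ≤ N r j := fun r j => by
    rw [hN]
    exact (Nat.one_le_floor_iff _).2 ((one_le_div (ha0pos r j)).2 (hlen r j))
  have hNr : ∀ r j, (1 : ℝ) ≤ N r j := fun r j => by exact_mod_cast hN1 r j
  have hNpos : ∀ r j, (0 : ℝ) < N r j := fun r j => zero_lt_one.trans_le (hNr r j)
  have hNle : ∀ r j, (N r j : ℝ) * a0 r j ≤ projLen (Xi r) j := fun r j => by
    rw [← le_div_iff₀ (ha0pos r j)]
    exact Nat.floor_le (div_pos (hlpos r j) (ha0pos r j)).le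
  have hNge : ∀ r j, projLen (Xi r) j ≤ 2 * a0 r j * N r j := fun r j => by
    have h1 := Nat.lt_floor_add_one (projLen (Xi r) j / a0 r j)
    rw [div_lt_iff₀ (ha0pos r j)] at h1
    change _ < ((N r j : ℝ) + 1) * _ at h1
    nlinarith [hNr r j, ha0pos r j]
  set w : Fin R → Fin d → ℝ := fun r j => projLen (Xi r) j / N r j with hw
  have hwge : ∀ r j, a0 r j ≤ w r j := fun r j => by
    rw [hw, le_div_iff₀ (hNpos r j), mul_comm]
    exact hNle r j
  have hwpos : ∀ r j, 0 < w r j := fun r j => (ha0pos r j).trans_le (hwge r j)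
  have hwN : ∀ r j, N r j * w r j = projLen (Xi r) j := fun r j =>
    mul_div_cancel₀ _ (hNpos r j).ne'
  set o : (k : Σ r : Fin R, ∀ j, Fin (N r j)) → Fin d → ℝ :=
    fun k j => a k.1 j + (k.2 j : ℕ) * w k.1 j with ho
  have hoa : ∀ k j, a k.1 j ≤ o k j := fun k j => by
    have := hwpos k.1 j
    simp only [ho]
    linarith [show 0 ≤ ((k.2 j : ℕ) : ℝ) * w k.1 j by positivity]
  have how : ∀ k j, o k j + w k.1 j ≤ a k.1 j + projLen (Xi k.1) j := fun k j => by
    have h1 : (((k.2 j : ℕ) : ℝ) + 1) ≤ N k.1 j := by exact_mod_cast (k.2 j).2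
    have := mul_le_mul_of_nonneg_right h1 (hwpos k.1 j).le
    rw [hwN] at this
    simp only [ho]
    linarith
  set φ : (Σ r : Fin R, ∀ j, Fin (N r j)) → Cube d → ℝ :=
    fun k => cellBump τ (o k) (w k.1) with hφ
  have hsupp : ∀ k x, φ k x ≠ 0 → x ∈ Xi k.1 := by
    intro k x hx
    refine hain k.1 x fun j => ?_
    have := mem_cell_of_cellBump_ne_zero (hwpos k.1) hx j
    exact ⟨(hoa k j).trans_lt this.1, this.2.trans_le (how k j)⟩
  have h0 : ∀ k x, 0 ≤ φ k x := fun k x => cellBump_nonneg hτ.le x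
  have hdisj : ∀ k l x, k ≠ l → φ k x = 0 ∨ φ l x = 0 := by
    intro k l x hkl
    by_contra hc
    push Not at hc
    apply hkl
    obtain ⟨r, i⟩ := k
    obtain ⟨s, i'⟩ := l
    have hrs : r = s := by
      by_contra hne
      exact Set.disjoint_left.1 (hXi.disjoint r s hne) (hsupp _ _ hc.1) (hsupp _ _ hc.2)
    subst hrs
    congr 1
    ext j
    have h1 := mem_cell_of_cellBump_ne_zero (hwpos r) hc.1 j
    have h2 := mem_cell_of_cellBump_ne_zero (hwpos r) hc.2 j
    simp only [ho] at h1 h2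
    have hp := hwpos r j
    have h3 : ((i j : ℕ) : ℝ) < (i' j : ℕ) + 1 := lt_of_mul_lt_mul_right (by linarith) hp.le
    have h4 : ((i' j : ℕ) : ℝ) < (i j : ℕ) + 1 := lt_of_mul_lt_mul_right (by linarith) hp.le
    norm_cast at h3 h4
    omega
  refine ⟨_, inferInstance, inferInstance, φ, fun k => continuous_cellBump, h0,
    fun k x => cellBump_le hτ.le x, hdisj, ?_, ?_, ?_⟩
  · have hcard : (Fintype.card (Σ r : Fin R, ∀ j, Fin (N r j)) : ℝ) = ∑ r, ∏ j, (N r j : ℝ) := by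
      simp [Fintype.card_sigma, Fintype.card_pi]
    rw [hcard, ← hXi.sum_prod_projLen hd hlpos, Finset.mul_sum]
    refine Finset.sum_le_sum fun r _ => ?_
    calc ∏ j, projLen (Xi r) j ≤ ∏ j, (2 * a0 r j * N r j) :=
          Finset.prod_le_prod (fun j _ => (hlpos r j).le) fun j _ => hNge r j
      _ = _ := by
          rw [Finset.prod_mul_distrib, Finset.prod_mul_distrib, hv]
          simp
  · intro k
    refine le_trans (ENNReal.ofReal_le_ofReal ?_) (lintegral_cellBump_sq_ge hτ.le (hwpos k.1)
      (fun j => (hapos k.1 j).trans (hoa k j)) fun j => (how k j).trans (ha1 k.1 j))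
    gcongr
    calc (1 / 2 : ℝ) ^ d * (τ / L) ^ ((d : ℝ) / abar) = ∏ j, (1 / 2 * a0 k.1 j) := by
          rw [Finset.prod_mul_distrib, hv]; simp
      _ ≤ ∏ j, (w k.1 j / 2) :=
          Finset.prod_le_prod (fun j _ => by linarith [ha0pos k.1 j]) fun j _ => by
            linarith [hwge k.1 j]
  · intro ω r x hx y hy
    refine abs_disjoint_sum_sub_le (mul_nonneg hL.le (Finset.sum_nonneg fun j _ => by positivity))
      h0 hdisj ω fun k => ?_
    by_cases hk : k.1 = r
    · subst hk
      exact abs_cellBump_sub_le hL hτ (hA k.1).1 (hwge k.1) x y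
    · have hz : ∀ z ∈ Xi r, φ k z = 0 := by
        intro z hz
        by_contra hc
        exact Set.disjoint_left.1 (hXi.disjoint _ _ hk) (hsupp k z hc) hz
      rw [hz x hx, hz y hy, sub_self, abs_zero]
      exact mul_nonneg hL.le (Finset.sum_nonneg fun j _ => by positivity)

end Boxes

/-! ### Passing from `d` to `p` coordinates and from Lebesgue measure to `Q`. -/

section Projection

variable {d p : ℕ}

theorem measurePreserving_comp_embedding {e : Fin d → Fin p} (he : Function.Injective e) :
    MeasurePreserving (fun (x : Cube p) j => x (e j)) := by
  have hm : Measurable (fun (x : Cube p) j => x (e j)) := by fun_prop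
  refine ⟨hm, (Measure.pi_eq fun s hs => ?_).symm⟩
  rw [Measure.map_apply hm (MeasurableSet.univ_pi hs)]
  -- This is `s j` at `i = e j` and the whole interval off the range of `e`, with no need to invert
  -- `e`.
  set B : Fin p → Set I := fun i => {y | ∀ j, e j = i → y ∈ s j} with hB
  have hpre : (fun (x : Cube p) j => x (e j)) ⁻¹' Set.univ.pi s = Set.univ.pi B := by
    ext x
    simp only [Set.mem_preimage, Set.mem_univ_pi, hB, Set.mem_ofPred_eq]
    exact ⟨fun h i j hj => hj ▸ h j, fun h j => h (e j) j rfl⟩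
  have hBe : ∀ j, B (e j) = s j := by
    intro j
    ext y
    exact ⟨fun h => h j rfl, fun h j' hj' => by rwa [he hj']⟩
  have hBu : ∀ i ∉ Finset.univ.map ⟨e, he⟩, volume (B i) = 1 := by
    intro i hi
    have : B i = Set.univ := by
      ext y
      simp only [hB, Set.mem_ofPred_eq, Set.mem_univ, iff_true]
      intro j hj
      exact absurd (Finset.mem_map.2 ⟨j, Finset.mem_univ j, hj⟩) hi
    rw [this, measure_univ]
  rw [hpre, volume_pi_pi, ← Finset.prod_subset (Finset.subset_univ _) fun i _ hi => hBu i hi,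
    Finset.prod_map]
  exact Finset.prod_congr rfl fun j _ => by rw [Function.Embedding.coeFn_mk, hBe]

theorem lintegral_liftCoords {S : Finset (Fin p)} (hS : S.card = d) {F : ℝ → ℝ≥0∞}
    (hF : Measurable F) {h : Cube d → ℝ} (hh : Measurable h) :
    ∫⁻ x, F (liftCoords S hS h x) = ∫⁻ x, F (h x) :=
  (measurePreserving_comp_embedding (S.orderEmbOfFin hS).injective).lintegral_comp (hF.comp hh)

theorem continuous_liftCoords {S : Finset (Fin p)} (hS : S.card = d) {h : Cube d → ℝ}
    (hh : Continuous h) : Continuous (liftCoords S hS h) := by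
  unfold liftCoords
  exact hh.comp (by fun_prop)

theorem HasDensityBetween.mul_lintegral_le {Q : Measure (Cube p)} {lo hi c : ℝ≥0∞}
    (hQ : HasDensityBetween Q lo hi) (hc : c ≤ lo) {F : Cube p → ℝ≥0∞} (hF : Measurable F) :
    c * ∫⁻ x, F x ≤ ∫⁻ x, F x ∂Q := by
  obtain ⟨q, hq, hb, rfl⟩ := hQ
  rw [lintegral_withDensity_eq_lintegral_mul _ hq hF, ← lintegral_const_mul _ hF]
  refine lintegral_mono fun x => ?_
  simp only [Pi.mul_apply]
  gcongr
  exact hc.trans (hb x).1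

end Projection

/-! ### Separated hypotheses for the choice of coordinates. -/

section Selection

variable {d p : ℕ}

/-- The scaled product of all coordinates. -/
noncomputable def coordProd (τ : ℝ) (x : Cube d) : ℝ := τ * ∏ j, (x j : ℝ)

theorem continuous_coordProd (τ : ℝ) : Continuous (coordProd (d := d) τ) := by
  unfold coordProd
  refine continuous_const.mul (continuous_finsetProd _ fun j _ => ?_)
  fun_prop

theorem coordProd_nonneg {τ : ℝ} (hτ : 0 ≤ τ) (x : Cube d) : 0 ≤ coordProd τ x :=
  mul_nonneg hτ (Finset.prod_nonneg fun j _ => (x j).2.1)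

theorem coordProd_le {τ : ℝ} (hτ : 0 ≤ τ) (x : Cube d) : coordProd τ x ≤ τ :=
  mul_le_of_le_one_right hτ (Finset.prod_le_one (fun j _ => (x j).2.1) fun j _ => (x j).2.2)

theorem coordProd_mem_piecewiseHolder {R : ℕ} {Xi : Fin R → Set (Cube d)}
    {A : Fin R → Fin d → ℝ} {abar L τ : ℝ} (hA : A ∈ smoothnessTuples R d abar)
    (hτ : 0 ≤ τ) (hτL : τ ≤ L) : coordProd τ ∈ piecewiseHolder L A Xi := by
  intro r x _ y _
  unfold coordProd
  rw [← mul_sub, abs_mul, abs_of_nonneg hτ]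
  refine mul_le_mul hτL ?_ (abs_nonneg _) (hτ.trans hτL)
  refine (abs_prod_sub_prod_le _ (fun j => (x j).2.1) (fun j => (x j).2.2) (fun j => (y j).2.1)
    fun j => (y j).2.2).trans (Finset.sum_le_sum fun j _ => ?_)
  exact abs_sub_le_rpow_of_unit (x j).2.1 (x j).2.2 (y j).2.1 (y j).2.2 le_rfl
    ((hA r).1 j).1 ((hA r).1 j).2

/-- For `i ∈ S \ T`, consider the box where `x i ≤ 2^-(d+1)` and all coordinates in `T` are at least
1/2. There the `T`-product is at least twice `2^-(d+1)`, while the `S`-product is at most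
`2^-(d+1)`. -/
theorem lintegral_liftCoords_coordProd_sub_sq_ge {τ : ℝ} (hτ : 0 ≤ τ) {S T : Finset (Fin p)}
    (hS : S.card = d) (hT : T.card = d) (hne : S ≠ T) :
    ENNReal.ofReal ((τ * (1 / 2) ^ (d + 1)) ^ 2 * ((1 / 2) ^ (d + 1) * (1 / 2) ^ d)) ≤
      ∫⁻ x, ENNReal.ofReal ((liftCoords S hS (coordProd τ) x -
        liftCoords T hT (coordProd τ) x) ^ 2) := by
  obtain ⟨i, hiS, hiT⟩ : ∃ i ∈ S, i ∉ T := by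
    by_contra hc
    push Not at hc
    exact hne (Finset.eq_of_subset_of_card_le hc (by rw [hS, hT]))
  let c : I := ⟨(1 / 2) ^ (d + 1), by positivity, pow_le_one₀ (by norm_num) (by norm_num)⟩
  let half : I := ⟨1 / 2, by norm_num, by norm_num⟩
  let B : Fin p → Set I := fun k =>
    if k = i then Set.Iic c else if k ∈ T then Set.Ici half else Set.univ
  have hBm : ∀ k, MeasurableSet (B k) := by
    intro k
    simp only [B]
    split_ifs
    · exact measurableSet_Iic
    · exact measurableSet_Ici
    · exact MeasurableSet.univ
  have hBv : ∀ k, volume (B k) = (if k = i then ENNReal.ofReal ((1 / 2) ^ (d + 1)) else 1) *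
      (if k ∈ T then ENNReal.ofReal (1 / 2) else 1) := by
    intro k
    simp only [B]
    by_cases hk : k = i
    · subst hk
      simp only [if_true, if_neg hiT, mul_one]
      rw [unitInterval.volume_Iic]
    · simp only [if_neg hk, one_mul]
      split_ifs
      · rw [unitInterval.volume_Ici]
        congr 1
        norm_num [half]
      · exact measure_univ
  have hvol : volume (Set.univ.pi B) = ENNReal.ofReal ((1 / 2) ^ (d + 1) * (1 / 2) ^ d) := by
    rw [volume_pi_pi]
    simp_rw [hBv]
    rw [Finset.prod_mul_distrib, Finset.prod_ite_eq' Finset.univ i,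
      if_pos (Finset.mem_univ i), Finset.prod_ite_mem, Finset.univ_inter, Finset.prod_const, hT,
      ENNReal.ofReal_mul (by positivity), ← ENNReal.ofReal_pow (by norm_num) d]
  rw [ENNReal.ofReal_mul (by positivity), ← hvol, ← setLIntegral_const]
  refine le_trans (setLIntegral_mono' (MeasurableSet.univ_pi hBm) fun x hx => ?_)
    (setLIntegral_le_lintegral _ _)
  apply ENNReal.ofReal_le_ofReal
  have hxi : (x i : ℝ) ≤ (1 / 2) ^ (d + 1) := by
    have := hx i trivial
    simp only [B, if_true] at this
    exact this
  have hxT : ∀ k ∈ T, (1 / 2 : ℝ) ≤ x k := by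
    intro k hk
    have := hx k trivial
    simp only [B, if_neg (ne_of_mem_of_not_mem hk hiT), if_pos hk] at this
    exact this
  have h1 : liftCoords S hS (coordProd τ) x ≤ τ * (1 / 2) ^ (d + 1) := by
    unfold liftCoords coordProd
    gcongr
    obtain ⟨j, hj⟩ : ∃ j, S.orderEmbOfFin hS j = i := by
      have : i ∈ Set.range (S.orderEmbOfFin hS) := by
        rw [Finset.range_orderEmbOfFin]; exact hiS
      exact this
    rw [← Finset.mul_prod_erase _ _ (Finset.mem_univ j)]
    change (x (S.orderEmbOfFin hS j) : ℝ) * _ ≤ _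
    rw [hj]
    exact (mul_le_of_le_one_right (x i).2.1 (Finset.prod_le_one (fun k _ => (x _).2.1)
      fun k _ => (x _).2.2)).trans hxi
  have h2 : τ * (1 / 2) ^ d ≤ liftCoords T hT (coordProd τ) x := by
    unfold liftCoords coordProd
    gcongr
    calc (1 / 2 : ℝ) ^ d = ∏ _j : Fin d, (1 / 2 : ℝ) := by simp
      _ ≤ _ := Finset.prod_le_prod (fun _ _ => by norm_num) fun j _ =>
        hxT _ (T.orderEmbOfFin_mem hT j)
  have h3 : τ * (1 / 2) ^ d = 2 * (τ * (1 / 2) ^ (d + 1)) := by ring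
  rw [← neg_sub, neg_sq]
  exact pow_le_pow_left₀ (by positivity) (by linarith) 2

end Selection

/-! ### Lower bounds for the two terms of the rate. -/

section RateBounds

variable {n p d R : ℕ} {L abar M c : ℝ} {Xi : Fin R → Set (Cube d)} {A : Fin R → Fin d → ℝ}
  {Q : Measure (Cube p)} {lo hi : ℝ≥0∞} {est : (Fin n → Cube p × ℝ) → Cube p → ℝ}

theorem selection_risk [IsProbabilityMeasure Q] (hn : 0 < n)
    (hA : A ∈ smoothnessTuples R d abar) (hQ : HasDensityBetween Q lo hi) (hc0 : 0 ≤ c)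
    (hc : ENNReal.ofReal c ≤ lo) (hest : Measurable (Function.uncurry est))
    (hN : 256 ≤ p.choose d) (hL : Real.sqrt ((n : ℝ)⁻¹ * Real.log (p.choose d)) ≤ L)
    (hM : Real.sqrt ((n : ℝ)⁻¹ * Real.log (p.choose d)) ≤ M * L) :
    ENNReal.ofReal (c * ((n : ℝ)⁻¹ * Real.log (p.choose d)) * (1 / 16) ^ d / 128) ≤
      ⨆ f ∈ boundedSparseHolder p L M A Xi ∩ {f | Continuous f}, l2Risk n Q est f := by
  have hn' : (0 : ℝ) < n := by exact_mod_cast hn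
  have hN' : (256 : ℝ) ≤ p.choose d := by exact_mod_cast hN
  set ρ : ℝ := (n : ℝ)⁻¹ * Real.log (p.choose d) with hρ
  have hρ0 : 0 ≤ ρ := mul_nonneg (by positivity) (Real.log_nonneg (by linarith))
  -- Then `exp(nτ²) = √C(p,d)`, which is at most `C(p,d)/16` exactly when `C(p,d) ≥ 256`.
  set τ : ℝ := Real.sqrt (ρ / 2) with hτ
  have hτ0 : 0 ≤ τ := Real.sqrt_nonneg _
  have hτsq : τ ^ 2 = ρ / 2 := Real.sq_sqrt (by positivity)
  have hτle : τ ≤ Real.sqrt ρ := Real.sqrt_le_sqrt (by linarith)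
  have hcard : Fintype.card {S : Finset (Fin p) // S.card = d} = p.choose d := by
    rw [Fintype.card_finset_len, Fintype.card_fin]
  have : Nonempty {S : Finset (Fin p) // S.card = d} := by
    rw [← Fintype.card_pos_iff, hcard]; omega
  set f : {S : Finset (Fin p) // S.card = d} → Cube p → ℝ :=
    fun S => liftCoords S.1 S.2 (coordProd τ) with hf
  have hfc : ∀ S, Continuous (f S) := fun S => continuous_liftCoords S.2 (continuous_coordProd τ)
  have hfb : ∀ S x, |f S x| ≤ τ := fun S x => by
    change |coordProd τ _| ≤ τ
    rw [abs_of_nonneg (coordProd_nonneg hτ0 _)]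
    exact coordProd_le hτ0 _
  have hexp : Real.exp (n * τ ^ 2) ≤
      (Fintype.card {S : Finset (Fin p) // S.card = d} : ℝ) / 16 := by
    rw [hcard, hτsq, hρ]
    have h1 : (n : ℝ) * ((n : ℝ)⁻¹ * Real.log (p.choose d) / 2) =
        Real.log (p.choose d) / 2 := by field_simp
    rw [h1, ← Real.log_sqrt (by linarith), Real.exp_log (Real.sqrt_pos.2 (by linarith))]
    have h2 : (16 : ℝ) ≤ Real.sqrt (p.choose d) := Real.le_sqrt_of_sq_le (by linarith)
    have h3 := Real.mul_self_sqrt (show (0 : ℝ) ≤ p.choose d by linarith)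
    nlinarith
  have hmain := multiple_hypotheses_risk (Q := Q) (n := n) hest (fun S => (hfc S).measurable)
    hfb hexp (D := c * ((τ * (1 / 2) ^ (d + 1)) ^ 2 * ((1 / 2) ^ (d + 1) * (1 / 2) ^ d)))
    (by positivity) (fun S T hST => by
      rw [ENNReal.ofReal_mul hc0]
      have hS := (hfc S).measurable
      have hT := (hfc T).measurable
      refine le_trans ?_ (hQ.mul_lintegral_le hc (by fun_prop))
      gcongr
      exact lintegral_liftCoords_coordProd_sub_sq_ge hτ0 S.2 T.2 fun h => hST (Subtype.ext h))
    (F := boundedSparseHolder p L M A Xi ∩ {f | Continuous f}) (fun S => ⟨⟨?_, fun x =>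
      (hfb S x).trans (hτle.trans hM)⟩, hfc S⟩)
  · refine le_trans (ENNReal.ofReal_le_ofReal (le_of_eq ?_)) hmain
    have h16 : (1 / 16 : ℝ) ^ d = ((1 / 2) ^ d) ^ 4 := by
      rw [← pow_mul, mul_comm d 4, pow_mul]; norm_num
    rw [mul_pow, hτsq, h16, pow_succ]
    ring
  · exact Set.mem_iUnion₂.2 ⟨S.1, S.2, coordProd τ,
      coordProd_mem_piecewiseHolder hA hτ0 (hτle.trans hL), rfl⟩

theorem smoothness_risk [IsProbabilityMeasure Q] (hd : 0 < d) (hdp : d ≤ p) (hL : 0 < L)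
    (hXi : IsBoxPartition Xi) (hA : A ∈ smoothnessTuples R d abar)
    (hQ : HasDensityBetween Q lo hi) (hc0 : 0 ≤ c) (hc : ENNReal.ofReal c ≤ lo)
    (hest : Measurable (Function.uncurry est)) {s : ℝ} (hs0 : 0 < s) (hs1 : s ≤ 1)
    (hM : s ≤ M * L) (hbal : n * s ^ 2 * (s / L) ^ ((d : ℝ) / abar) = 1)
    (hlen : ∀ r j, (s / L) ^ (A r j)⁻¹ ≤ projLen (Xi r) j) :
    ENNReal.ofReal (c * s ^ 2 * Real.exp (-(2 * 2 ^ d)) * (1 / 64) ^ d / 8) ≤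
      ⨆ f ∈ boundedSparseHolder p L M A Xi ∩ {f | Continuous f}, l2Risk n Q est f := by
  obtain ⟨κ, _, _, φ, hφc, h0, hφs, hdisj, hcard, hint, hmem⟩ := exists_bumps hXi hd hA hL hs0 hlen
  obtain ⟨S, -, hS⟩ := Finset.exists_subset_card_eq (s := (Finset.univ : Finset (Fin p)))
    (n := d) (by simpa using hdp)
  have hcont : ∀ k, Continuous (liftCoords S hS (φ k)) := fun k =>
    continuous_liftCoords hS (hφc k)
  have hv : 0 < (s / L) ^ ((d : ℝ) / abar) := Real.rpow_pos_of_pos (by positivity) _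
  set v := (s / L) ^ ((d : ℝ) / abar) with hvdef
  have hmain := hypercube_risk (Q := Q) (n := n) hest (φ := fun k => liftCoords S hS (φ k))
    (fun k => (hcont k).measurable) (τ := s) (c := 2 ^ d) hs1 (fun k x => h0 k _)
    (fun k x => hφs k _) (fun k l x hkl => hdisj k l _ hkl) (by
      have h1 : (n : ℝ) * s ^ 2 * v ≤ 2 ^ d * Fintype.card κ * v := by rw [hbal]; linarith
      exact le_of_mul_le_mul_right h1 hv)
    (s := ENNReal.ofReal (c * ((s * (1 / 4) ^ d) ^ 2 * ((1 / 2) ^ d * v))))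
    (fun k => by
      have hk := (hcont k).measurable
      rw [ENNReal.ofReal_mul hc0]
      refine le_trans ?_ (hQ.mul_lintegral_le hc (by fun_prop))
      gcongr
      rw [lintegral_liftCoords hS (F := fun y => ENNReal.ofReal (y ^ 2)) (by fun_prop)
        (hφc k).measurable]
      exact hint k)
    (F := boundedSparseHolder p L M A Xi ∩ {f | Continuous f}) (fun ω => ⟨⟨?_, fun x => ?_⟩, ?_⟩)
  · refine le_trans ?_ hmain
    rw [← ENNReal.ofReal_mul (by positivity)]
    apply ENNReal.ofReal_le_ofReal
    -- The factors come from the bump height on the central part of a cell, squared, the volume of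
    -- that part, and the number of cells.
    have h64 : (1 / 64 : ℝ) ^ d = ((1 / 4) ^ d) ^ 2 * ((1 / 2) ^ d * (1 / 2) ^ d) := by
      rw [← pow_mul, mul_comm d 2, pow_mul, ← mul_pow, ← mul_pow]; norm_num
    have h2 : (1 / 2 : ℝ) ^ d ≤ Fintype.card κ * v := by
      rw [one_div, inv_pow, inv_le_iff_one_le_mul₀ (by positivity)]
      linarith
    rw [h64]
    have hK : 0 ≤ c * s ^ 2 * Real.exp (-(2 * 2 ^ d)) / 8 * ((1 / 4) ^ d) ^ 2 * (1 / 2) ^ d := by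
      positivity
    have := mul_le_mul_of_nonneg_left h2 hK
    linarith
  · exact Set.mem_iUnion₂.2 ⟨S, hS, _, hmem ω, rfl⟩
  · exact (abs_disjoint_sum_le (x := fun i => x (S.orderEmbOfFin hS i)) hs0.le h0 hdisj ω
      fun k => hφs k _).trans hM
  · refine continuous_finsetSum _ fun k _ => ?_
    by_cases h : ω k
    · simpa [h] using hcont k
    · simpa [h] using continuous_const

theorem smoothness_rate_balance (hn : 0 < n) (hd : 0 < d) (hL : 0 < L) (ha : 0 < abar) {s : ℝ}
    (hs : s = (L ^ ((d : ℝ) / abar) / n) ^ (abar / (2 * abar + d))) :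
    0 < s ∧ n * s ^ 2 * (s / L) ^ ((d : ℝ) / abar) = 1 := by
  have hn' : (0 : ℝ) < n := by exact_mod_cast hn
  have hd' : (0 : ℝ) < d := by exact_mod_cast hd
  have hb : 0 < L ^ ((d : ℝ) / abar) / n := by positivity
  have hs0 : 0 < s := hs ▸ Real.rpow_pos_of_pos hb _
  refine ⟨hs0, ?_⟩
  have h1 : s ^ (2 + (d : ℝ) / abar) = L ^ ((d : ℝ) / abar) / n := by
    rw [hs, ← Real.rpow_mul hb.le]
    have : abar / (2 * abar + d) * (2 + (d : ℝ) / abar) = 1 := by field_simp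
    rw [this, Real.rpow_one]
  rw [Real.rpow_add hs0, Real.rpow_two] at h1
  rw [Real.div_rpow hs0.le hL.le, mul_div_assoc', mul_assoc, h1]
  have : 0 < L ^ ((d : ℝ) / abar) := by positivity
  field_simp

end RateBounds

/-! ### Combination of the two bounds. -/

theorem mainTheorem2 (qlo qhi : ℝ≥0∞) (hqlo : 0 < qlo) (hq : qlo ≤ qhi) :
    ∃ Md : ℕ → ℝ, (∀ k, 0 < Md k) ∧
      ∀ (M : ℝ) (d p R : ℕ → ℕ) (L abar : ℕ → ℝ)
        (Xi : ∀ n, Fin (R n) → Set (Cube (d n)))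
        (A : ∀ n, Fin (R n) → Fin (d n) → ℝ)
        (Q : ∀ n, Measure (Cube (p n))),
        0 < M →
        (∀ n, 0 < d n ∧ d n ≤ p n) →
        (∀ n, 0 < R n) →
        (∀ n, 0 < L n) →
        (∀ n, 0 < abar n ∧ abar n ≤ 1) →
        (∀ n, IsBoxPartition (Xi n)) →
        (∀ n, A n ∈ smoothnessTuples (R n) (d n) (abar n)) →
        (∃ C : ℝ, 0 < C ∧ ∀ n r j,
          0 < projLen (Xi n r) j ∧ -C / A n r j ≤ Real.log (projLen (Xi n r) j)) →
        (∀ n, IsProbabilityMeasure (Q n)) →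
        (∀ n, HasDensityBetween (Q n) qlo qhi) →
        ((fun n => minimaxRate n (p n) (d n) (L n) (abar n)) =o[atTop]
          fun n => 1 / (d n : ℝ)) →
        ((fun n => minimaxRate n (p n) (d n) (L n) (abar n)) =o[atTop] L) →
        ∀ᶠ n in atTop,
          ENNReal.ofReal (Md (d n) * minimaxRate n (p n) (d n) (L n) (abar n)) ≤
            minimaxL2Risk n
              (boundedSparseHolder (p n) (L n) M (A n) (Xi n) ∩ {f | Continuous f}) (Q n) := by
  -- The minimum with 1 matters because `toReal` sends `∞` to 0.
  set c : ℝ := (min qlo 1).toReal with hcdef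
  have hmin_top : min qlo 1 ≠ ∞ := ne_top_of_le_ne_top ENNReal.one_ne_top (min_le_right _ _)
  have hc0 : 0 < c := ENNReal.toReal_pos (lt_min hqlo one_pos).ne' hmin_top
  have hc : ENNReal.ofReal c ≤ qlo := by
    rw [hcdef, ENNReal.ofReal_toReal hmin_top]; exact min_le_left _ _
  set K : ℕ → ℝ := fun k => c * Real.exp (-(2 * 2 ^ k)) * (1 / 64) ^ k / 128 with hK
  have hKpos : ∀ k, 0 < K k := fun k => by positivity
  refine ⟨fun k => Real.sqrt (K k) / 4, fun k => by have := hKpos k; positivity, ?_⟩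
  intro M d p R L abar Xi A Q hM hdp hR hL habar hXi hA hlen hQ hQd ho1 ho2
  obtain ⟨C, hC0, hC⟩ := hlen
  -- Eventually the rate is below three multiples of `L`: `exp(-C)` makes a cell fit into every box,
  -- `M` gives the supremum bound, and 1 gives the Hölder bound for the coordinate products and `s ≤
  -- L`.
  have hevL := ho2.def (c := min (Real.exp (-C)) (min M 1)) (by positivity)
  have hev1 := ho1.def (c := 1) one_pos
  filter_upwards [hevL, hev1, eventually_gt_atTop 0] with n hnL hn1 hn0
  have := hQ n
  have hn' : (0 : ℝ) < n := by exact_mod_cast hn0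
  obtain ⟨hd0, hdpn⟩ := hdp n
  have hd1 : (1 : ℝ) ≤ d n := by exact_mod_cast hd0
  have hL0 := hL n
  set ρ : ℝ := (n : ℝ)⁻¹ * Real.log ((p n).choose (d n)) with hρ
  obtain ⟨s, hs⟩ : ∃ s, s = (L n ^ ((d n : ℝ) / abar n) / n) ^ (abar n / (2 * abar n + d n)) :=
    ⟨_, rfl⟩
  have hrate : minimaxRate n (p n) (d n) (L n) (abar n) = Real.sqrt ρ + s := by
    rw [minimaxRate, ← hs]
  rw [hrate] at hnL hn1 ⊢
  obtain ⟨hs0, hbal⟩ := smoothness_rate_balance hn0 hd0 hL0 (habar n).1 hs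
  have hsq0 := Real.sqrt_nonneg ρ
  have hγ0 : 0 ≤ Real.sqrt ρ + s := by linarith
  rw [Real.norm_of_nonneg hγ0, Real.norm_of_nonneg hL0.le] at hnL
  rw [Real.norm_of_nonneg hγ0, Real.norm_of_nonneg (by positivity), one_mul] at hn1
  have hs1 : s ≤ 1 := by
    have : 1 / (d n : ℝ) ≤ 1 := by rw [div_le_one (by linarith)]; exact hd1
    linarith
  have hγL : ∀ b, min (Real.exp (-C)) (min M 1) ≤ b → Real.sqrt ρ + s ≤ b * L n := fun b hb =>
    hnL.trans (mul_le_mul_of_nonneg_right hb hL0.le)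
  have hγC := hγL (Real.exp (-C)) (min_le_left _ _)
  have hγM := hγL M ((min_le_right _ _).trans (min_le_left _ _))
  have hγ1 := hγL 1 ((min_le_right _ _).trans (min_le_right _ _))
  have hlens : ∀ r j, (s / L n) ^ (A n r j)⁻¹ ≤ projLen (Xi n r) j := by
    intro r j
    have hα := ((hA n r).1 j).1
    have h1 : s / L n ≤ Real.exp (-C) := by rw [div_le_iff₀ hL0]; linarith
    calc (s / L n) ^ (A n r j)⁻¹ ≤ Real.exp (-C) ^ (A n r j)⁻¹ :=
          Real.rpow_le_rpow (by positivity) h1 (by positivity)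
      _ = Real.exp (-C / A n r j) := by rw [← Real.exp_mul, div_eq_mul_inv]
      _ ≤ Real.exp (Real.log (projLen (Xi n r) j)) := Real.exp_le_exp.2 (hC n r j).2
      _ = _ := Real.exp_log (hC n r j).1
  -- The balance equation with its last factor at most one: `s` is never below the parametric rate.
  have hns : (n : ℝ)⁻¹ ≤ s ^ 2 := by
    have h1 : (s / L n) ^ ((d n : ℝ) / abar n) ≤ 1 :=
      Real.rpow_le_one (by positivity) (by rw [div_le_one hL0]; linarith)
        (div_nonneg (by linarith) (habar n).1.le)
    rw [inv_le_iff_one_le_mul₀ hn', mul_comm, ← hbal]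
    exact mul_le_of_le_one_right (by positivity) h1
  have hN1 : 1 ≤ (p n).choose (d n) := Nat.choose_pos hdpn
  have hN1' : (1 : ℝ) ≤ (p n).choose (d n) := by exact_mod_cast hN1
  have hρ0 : 0 ≤ ρ := mul_nonneg (by positivity) (Real.log_nonneg hN1')
  have hfin : ENNReal.ofReal (K (d n) * (Real.sqrt ρ + s) ^ 2 / 16) ≤
      ⨅ (est : (Fin n → Cube (p n) × ℝ) → Cube (p n) → ℝ) (_ : Measurable (Function.uncurry est)),
        ⨆ f ∈ boundedSparseHolder (p n) (L n) M (A n) (Xi n) ∩ {f | Continuous f},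
          l2Risk n (Q n) est f := by
    refine le_iInf₂ fun est hest => ?_
    have hsm := smoothness_risk (Q := Q n) (n := n) (M := M) hd0 hdpn hL0 (hXi n) (hA n) (hQd n)
      hc0.le hc hest hs0 hs1 (by linarith) hbal hlens
    have hsmall : Real.sqrt ρ ≤ 3 * s → ENNReal.ofReal (K (d n) * (Real.sqrt ρ + s) ^ 2 / 16) ≤
        ⨆ f ∈ boundedSparseHolder (p n) (L n) M (A n) (Xi n) ∩ {f | Continuous f},
          l2Risk n (Q n) est f := by
      intro h
      refine le_trans (ENNReal.ofReal_le_ofReal ?_) hsm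
      have h1 : (Real.sqrt ρ + s) ^ 2 ≤ (4 * s) ^ 2 := pow_le_pow_left₀ hγ0 (by linarith) 2
      have h2 := mul_le_mul_of_nonneg_left h1 (hKpos (d n)).le
      have h3 : 0 ≤ K (d n) * s ^ 2 := mul_nonneg (hKpos _).le (sq_nonneg s)
      have h4 : c * s ^ 2 * Real.exp (-(2 * 2 ^ d n)) * (1 / 64) ^ d n / 8 =
          16 * (K (d n) * s ^ 2) := by rw [hK]; ring
      rw [h4]
      linarith
    rcases le_or_gt (Real.sqrt ρ) (3 * s) with h | h
    · exact hsmall h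
    · by_cases hN : 256 ≤ (p n).choose (d n)
      · have hsel := selection_risk (Q := Q n) (n := n) (M := M) (Xi := Xi n) hn0 (hA n) (hQd n)
          hc0.le hc hest hN (show Real.sqrt ρ ≤ L n by linarith)
          (show Real.sqrt ρ ≤ M * L n by linarith)
        refine le_trans (ENNReal.ofReal_le_ofReal ?_) hsel
        have h1 : (Real.sqrt ρ + s) ^ 2 ≤ 4 * ρ := by
          have h5 : (Real.sqrt ρ + s) ^ 2 ≤ (2 * Real.sqrt ρ) ^ 2 :=
            pow_le_pow_left₀ hγ0 (by linarith) 2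
          rw [mul_pow, Real.sq_sqrt hρ0] at h5
          linarith
        have h2 := mul_le_mul_of_nonneg_left h1 (hKpos (d n)).le
        have h3 : K (d n) ≤ c * (1 / 16) ^ d n / 128 := by
          have he : Real.exp (-(2 * 2 ^ d n)) ≤ 1 :=
            Real.exp_le_one_iff.2 (by simp)
          have h64 : (1 / 64 : ℝ) ^ d n ≤ (1 / 16) ^ d n := by gcongr; norm_num
          calc K (d n) ≤ c * 1 * (1 / 16) ^ d n / 128 := by
                simp only [hK]; gcongr
            _ = _ := by ring
        have h4 := mul_le_mul_of_nonneg_right h3 hρ0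
        have h5 : 0 ≤ K (d n) * ρ := mul_nonneg (hKpos _).le hρ0
        linarith
      -- Here `log C(p,d) ≤ 6`, so `ρ ≤ 6/n ≤ 6s²`, and the smoothness bound suffices after all.
      · refine hsmall ?_
        have hlog : Real.log ((p n).choose (d n)) ≤ 6 := by
          have h1 : ((p n).choose (d n) : ℝ) ≤ 2 ^ 8 := by
            have : (p n).choose (d n) ≤ 2 ^ 8 := by omega
            exact_mod_cast this
          calc Real.log ((p n).choose (d n)) ≤ Real.log (2 ^ 8) :=
                Real.log_le_log (by linarith) h1
            _ = 8 * Real.log 2 := by rw [Real.log_pow]; norm_num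
            _ ≤ 6 := by linarith [Real.log_two_lt_d9]
        rw [Real.sqrt_le_left (by linarith)]
        calc ρ ≤ s ^ 2 * 6 := mul_le_mul hns hlog (Real.log_nonneg hN1') (sq_nonneg s)
          _ ≤ (3 * s) ^ 2 := by nlinarith [sq_nonneg s]
  rw [minimaxL2Risk]
  have hx0 : 0 ≤ Real.sqrt (K (d n)) / 4 * (Real.sqrt ρ + s) := by positivity
  have hroot : ENNReal.ofReal (Real.sqrt (K (d n)) / 4 * (Real.sqrt ρ + s)) =
      ENNReal.ofReal (K (d n) * (Real.sqrt ρ + s) ^ 2 / 16) ^ (1 / 2 : ℝ) := by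
    have hsqr : K (d n) * (Real.sqrt ρ + s) ^ 2 / 16 =
        (Real.sqrt (K (d n)) / 4 * (Real.sqrt ρ + s)) ^ 2 := by
      rw [mul_pow, div_pow, Real.sq_sqrt (hKpos _).le]; ring
    rw [hsqr, ENNReal.ofReal_rpow_of_nonneg (sq_nonneg _) (by norm_num), ← Real.sqrt_eq_rpow,
      Real.sqrt_sq hx0]
  rw [hroot]
  exact ENNReal.rpow_le_rpow hfin (by norm_num)
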